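/- Throughout, a system $A$ of linear equations is $A'x=a$ with an integer matrix $A'$ (the underlying matrix, of any dimensions) and an integer vector $a$; for an integer matrix $M$ we also speak of the homogeneous system $Mx=0$. A solution is \emph{distinct} if its entries are pairwise distinct; a system (or a matrix $M$, via $Mx=0$) is \emph{irredundant} if it has a distinct solution in the positive integers. A set $S$ is $(A,B)$-\emph{Rado} if for every red/blue colouring of $S$ there is a distinct solution of $A$ in $S$ that is entirely red or a distinct solution of $B$ in $S$ that is entirely blue. $[n]_p$ is the random subset of $\{1,\dots,n\}$ containing each element independently with probability $p$. For a matrix $M$ with column set $[q]$ and $W\subseteq[q]$, let $M_{\overline W}$ consist of the columns outside $W$ (rank $0$ if there are none), and put $$m(M)=\max_{|W|\ge 2}\frac{|W|-1}{|W|-1+\operatorname{rank}(M_{\overline W})-\operatorname{rank}(M)},\qquad m(M,N)=\max_{|W|\ge 2}\frac{|W|}{|W|-1+\operatorname{rank}(M_{\overline W})-\operatorname{rank}(M)+1/m(N)}.$$ For systems, $m(A,B):=m(A',B')$. $M$ satisfies $(*)$ if no matrix obtained from $M$ by rational elementary row operations has a row with exactly two non-zero entries. An $\ell\times k$ matrix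 $C$ of rank $\ell$ is \emph{strictly balanced} if $\frac{|W|-1}{|W|-1+\operatorname{rank}(C_{\overline W})-\ell}<\frac{k-1}{k-1-\ell}$ for all $W\subseteq[k]$ with $2\le|W|<k$. A \emph{core} of $M$ is an integer matrix $C$ that is obtained from $M$ by rational elementary row operations followed by deleting rows and columns, where the remaining rows are zero in the deleted columns, and that is irredundant, of full rank, strictly balanced and satisfies $m(C)=m(M)$. \textbf{Theorem.} Let $k,\ell$ be positive integers with $k\ge \ell+2$. There is a constant $c>0$ (depending only on $k$ and $\ell$) such that the following holds. Let $A$ and $B$ be systems of linear equations such that $A$, $B$ and their underlying matrices are irredundant, both underlying matrices satisfy $(*)$, and both underlying matrices have a core of dimension $\ell\times k$. Then $\frac1{m(A,B)}=\frac{k-\ell-1}{k-1}$, and if $p=p(n)\in[0,1]$ satisfies $$p\le c\,n^{-1/m(A,B)}=c\,n^{-\frac{k-\ell-1}{k-1}}$$ for all sufficiently large $n$, then $\lim_{n\to\infty}\mathbb P\big[[n]_p\text{ is }(A,B)\text{-Rado}\big]=0$. -/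

import Mathlib

open Filter Topology

/-- A finite system of linear equations `matrix * x = rhs` with integer coefficients; `matrix` is
the underlying matrix of the system. -/
structure LinearSystem where
  rows : ℕ
  cols : ℕ
  matrix : Matrix (Fin rows) (Fin cols) ℤ
  rhs : Fin rows → ℤ

namespace LinearSystem

/-- The homogeneous system `M x = 0`. -/
def homogeneous {ℓ k : ℕ} (M : Matrix (Fin ℓ) (Fin k) ℤ) : LinearSystem := ⟨ℓ, k, M, 0⟩

/-- `x` is a solution of the system `A` in `S` whose entries are pairwise distinct. -/
def IsDistinctSolution (A : LinearSystem) (S : Set ℕ) (x : Fin A.cols → ℕ) : Prop :=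
  (∀ j, x j ∈ S) ∧ Function.Injective x ∧ A.matrix.mulVec (fun j => (x j : ℤ)) = A.rhs

/-- There is a solution with pairwise distinct entries in the positive integers. -/
def Irredundant (A : LinearSystem) : Prop :=
  ∃ x : Fin A.cols → ℕ, A.IsDistinctSolution (Set.Ioi 0) x

/-- `S` is `(A₁, …, A_r)`-Rado: every `r`-colouring of `S` yields, for some `i`, a solution of `A i`
in `S` with pairwise distinct entries, all of colour `i`. (Colourings of `S` are given as restrictions
of colourings of `ℕ`.) -/
def IsRado {r : ℕ} (A : Fin r → LinearSystem) (S : Set ℕ) : Prop :=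
  ∀ χ : ℕ → Fin r, ∃ i, ∃ x : Fin (A i).cols → ℕ,
    (A i).IsDistinctSolution S x ∧ ∀ j, χ (x j) = i

end LinearSystem

namespace RadoMatrix

/-- The integer matrix `M` with its entries read as rationals. -/
def toRat {ℓ k : ℕ} (M : Matrix (Fin ℓ) (Fin k) ℤ) : Matrix (Fin ℓ) (Fin k) ℚ :=
  M.map (fun z : ℤ => (z : ℚ))

/-- The rank of `M`. -/
noncomputable def rk {ℓ k : ℕ} (M : Matrix (Fin ℓ) (Fin k) ℤ) : ℕ := (toRat M).rank

/-- The rank of the matrix formed by the columns of `M` that are not indexed by `W`. -/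
noncomputable def rkCompl {ℓ k : ℕ} (M : Matrix (Fin ℓ) (Fin k) ℤ) (W : Finset (Fin k)) : ℕ :=
  ((toRat M).submatrix id (fun j : {j : Fin k // j ∉ W} => (j : Fin k))).rank

/-- `m(M)`, the maximum over all `W` with `|W| ≥ 2` of
`(|W| - 1) / (|W| - 1 + rank(M_{Wᶜ}) - rank(M))`. -/
noncomputable def m {ℓ k : ℕ} (M : Matrix (Fin ℓ) (Fin k) ℤ) : ℝ :=
  ⨆ W : {W : Finset (Fin k) // 2 ≤ W.card},
    ((W.1.card : ℝ) - 1) / ((W.1.card : ℝ) - 1 + (rkCompl M W.1 : ℝ) - (rk M : ℝ))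

/-- `m(M, N)`, the maximum over all sets `W` of columns of `M` with `|W| ≥ 2` of
`|W| / (|W| - 1 + rank(M_{Wᶜ}) - rank(M) + 1 / m(N))`. -/
noncomputable def mPair {ℓ k ℓ' k' : ℕ} (M : Matrix (Fin ℓ) (Fin k) ℤ)
    (N : Matrix (Fin ℓ') (Fin k') ℤ) : ℝ :=
  ⨆ W : {W : Finset (Fin k) // 2 ≤ W.card},
    (W.1.card : ℝ) /
      ((W.1.card : ℝ) - 1 + (rkCompl M W.1 : ℝ) - (rk M : ℝ) + 1 / m N)

/-- Property `(*)`: no matrix obtained from `M` by (invertible, rational) row operations has a row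
with exactly two nonzero entries. -/
def PropertyStar {ℓ k : ℕ} (M : Matrix (Fin ℓ) (Fin k) ℤ) : Prop :=
  ∀ U : Matrix (Fin ℓ) (Fin ℓ) ℚ, IsUnit U →
    ∀ i, (Finset.univ.filter fun j => (U * toRat M) i j ≠ 0).card ≠ 2

/-- An `ℓ × k` matrix of full (row) rank is strictly balanced if
`(|W| - 1) / (|W| - 1 + rank(M_{Wᶜ}) - ℓ) < (k - 1) / (k - 1 - ℓ)` whenever `2 ≤ |W| < k`. -/
def StrictlyBalanced {ℓ k : ℕ} (M : Matrix (Fin ℓ) (Fin k) ℤ) : Prop :=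
  rk M = ℓ ∧ ∀ W : Finset (Fin k), 2 ≤ W.card → W.card < k →
    ((W.card : ℝ) - 1) / ((W.card : ℝ) - 1 + (rkCompl M W : ℝ) - (ℓ : ℝ)) <
      ((k : ℝ) - 1) / ((k : ℝ) - 1 - (ℓ : ℝ))

/-- `C` is a core of `M`: after row operations on `M` one keeps the rows `ρ` and the columns `σ`,
where the rows kept vanish on the deleted columns (so that deleting these columns keeps valid
equations), and the resulting matrix `C` is irredundant, strictly balanced (in particular of full
rank) and satisfies `m(C) = m(M)`. -/
def IsCore {ℓ' k' ℓ k : ℕ} (M : Matrix (Fin ℓ') (Fin k') ℤ) (C : Matrix (Fin ℓ) (Fin k) ℤ) :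
    Prop :=
  (∃ U : Matrix (Fin ℓ') (Fin ℓ') ℚ, IsUnit U ∧
    ∃ (ρ : Fin ℓ ↪o Fin ℓ') (σ : Fin k ↪o Fin k'),
      toRat C = (U * toRat M).submatrix ρ σ ∧
      ∀ i, ∀ j, j ∉ Set.range σ → (U * toRat M) (ρ i) j = 0) ∧
  (LinearSystem.homogeneous C).Irredundant ∧ StrictlyBalanced C ∧ m C = m M

end RadoMatrix

/-! If the random set is Rado for the pair, then the solutions in it of the two core systems, each
carrying its colour, form an unavoidable family of `k`-element edges: every colouring makes some
edge monochromatic in its own colour (`isUnavoidable_of_isRado`). In a minimal unavoidable subfamily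
every edge has, at each of its vertices, another edge that meets it only there
(`exists_inter_eq_singleton`). It remains to see that such a family is unlikely to live in a random
set.

Probability. Put y = n^(1/(k-1)), so that p ≤ c·y^(-(k-1-ℓ)). An edge whose entries at the positions
J lie in a given set can be attached in at most a constant times n^(k-|J|-rank) ways and needs k-|J|
new points. By `exponent_identity` the expected number of attachments is of order at most y^(-cost).
By (*) and strict balance (`StrictlyBalanced.isTight`) the cost is 0 for |J| = 1, exactly ℓ for |J|
= 2, and at least 1 for 2 ≤ |J| < k. The first edge contributes a factor of order y^ℓ, so an
exploration with O(log n) edges, at most four free steps and cost above ℓ is unlikely. For small c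
each non-free step contributes a factor of at most 1/e, so explorations without free steps have
fewer than log n + 2 edges, with high probability. Together these say that the minimal family is
sparse (`prob_unavoidable_le`).

Structure. In a sparse family a longest simple path closes up to a simple cycle
(`IsSparse.exists_cycle`). Exploring a cycle costs ℓ, the entire budget, so nothing attached later
may cost anything. Hence every edge that meets the cycle lies inside it
(`IsSparse.subset_of_inter_cycle`), and a shortest cycle has to be a triangle with k = 3
(`IsSparse.exists_triangle`). A triangle can be recoloured without making any edge monochromatic in
its own colour, against unavoidability (`IsSparse.not_minimal`). -/

namespace RadoHypergraph

/-! ### Explorations, simple paths and simple cycles -/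

variable {E : Type*}

/-- Explorations of a hypergraph with edge set `H`: edges are added one at a time. `Exploration V F H
s r q X e` says that after `s` edges, `r` of them added freely, with total cost `q`, the explored
vertex set is `X` and the last edge is `e`. A step that is not free has to meet the explored set in
exactly one vertex, lying in the previous edge. -/
inductive Exploration (V : E → Finset ℕ) (F : E → Finset ℕ → ℕ) (H : Set E) :
    ℕ → ℕ → ℕ → Finset ℕ → E → Prop
  | start (e : E) (he : e ∈ H) : Exploration V F H 1 0 0 (V e) e
  | ext {s r q : ℕ} {X : Finset ℕ} {e : E} (h : Exploration V F H s r q X e) (e' : E) (he' : e' ∈ H)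
      (h1 : (V e' ∩ X).card = 1) (h2 : (V e' ∩ V e).Nonempty) :
      Exploration V F H (s + 1) r q (X ∪ V e') e'
  | free {s r q : ℕ} {X : Finset ℕ} {e : E} (h : Exploration V F H s r q X e) (e' : E)
      (he' : e' ∈ H) (h1 : (V e' ∩ X).Nonempty) :
      Exploration V F H (s + 1) (r + 1) (q + F e' (V e' ∩ X)) (X ∪ V e') e'

/-- The explored set lies in every set that contains all edges. -/
theorem Exploration.subset {V : E → Finset ℕ} {F : E → Finset ℕ → ℕ} {H : Set E} {s r q : ℕ}
    {X : Finset ℕ} {e : E} (h : Exploration V F H s r q X e) {S : Set ℕ}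
    (hS : ∀ e ∈ H, (V e : Set ℕ) ⊆ S) : (X : Set ℕ) ⊆ S := by
  induction h with
  | start e he => exact hS e he
  | ext h e' he' h1 h2 ih => simpa using ⟨ih, hS e' he'⟩
  | free h e' he' h1 ih => simpa using ⟨ih, hS e' he'⟩

theorem Exploration.mono {V : E → Finset ℕ} {F : E → Finset ℕ → ℕ} {H H' : Set E} (hH : H ⊆ H')
    {s r q : ℕ} {X : Finset ℕ} {e : E} (h : Exploration V F H s r q X e) :
    Exploration V F H' s r q X e := by
  induction h with
  | start e he => exact .start e (hH he)
  | ext h e' he' h1 h2 ih => exact .ext ih e' (hH he') h1 h2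
  | free h e' he' h1 ih => exact .free ih e' (hH he') h1

theorem Exploration.last_subset {V : E → Finset ℕ} {F : E → Finset ℕ → ℕ} {H : Set E}
    {s r q : ℕ} {X : Finset ℕ} {e : E} (h : Exploration V F H s r q X e) : V e ⊆ X := by
  cases h <;> grind

/-- A simple path `e 0, …, e t`: consecutive edges share one vertex, all others are disjoint. -/
structure IsSimplePath (V : E → Finset ℕ) (H : Set E) (e : ℕ → E) (t : ℕ) : Prop where
  mem : ∀ i ≤ t, e i ∈ H
  link : ∀ i < t, (V (e (i + 1)) ∩ V (e i)).card = 1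
  disj : ∀ i j, i + 1 < j → j ≤ t → V (e j) ∩ V (e i) = ∅

/-- A simple cycle: a simple path `e 0, …, e t` of at least two edges, closed by an edge `g`. -/
structure IsSimpleCycle (V : E → Finset ℕ) (H : Set E) (e : ℕ → E) (t : ℕ) (g : E) (a b : ℕ) :
    Prop where
  path : IsSimplePath V H e t
  pos : 1 ≤ t
  mem : g ∈ H
  first : V g ∩ V (e 0) = {a}
  last : V g ∩ V (e t) = {b}
  ne : a ≠ b
  mid : ∀ j, 0 < j → j < t → V g ∩ V (e j) = ∅

variable {V : E → Finset ℕ} {F : E → Finset ℕ → ℕ} {H : Set E}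

theorem IsSimplePath.rev {e : ℕ → E} {t : ℕ} (h : IsSimplePath V H e t) :
    IsSimplePath V H (fun j => e (t - j)) t where
  mem i hi := h.mem _ (by omega)
  link i hi := by
    have := h.link (t - (i + 1)) (by omega)
    rw [show t - (i + 1) + 1 = t - i by omega] at this
    rwa [Finset.inter_comm]
  disj i j hij hj := by
    have := h.disj (t - j) (t - i) (by omega) (by omega)
    rwa [Finset.inter_comm]

theorem IsSimplePath.shift {e : ℕ → E} {t : ℕ} (h : IsSimplePath V H e t) {i t' : ℕ}
    (hi : i + t' ≤ t) : IsSimplePath V H (fun j => e (i + j)) t' where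
  mem j hj := h.mem _ (by omega)
  link j hj := h.link (i + j) (by omega)
  disj j j' hij hj := h.disj (i + j) (i + j') (by omega) (by omega)

/-- Appending an edge to a simple path. -/
theorem IsSimplePath.append {e : ℕ → E} {t : ℕ} (h : IsSimplePath V H e t) {g : E} (hg : g ∈ H)
    (h1 : (V g ∩ V (e t)).card = 1) (h2 : ∀ j < t, V g ∩ V (e j) = ∅) :
    IsSimplePath V H (fun j => if j ≤ t then e j else g) (t + 1) where
  mem j hj := by
    split_ifs with h'
    · exact h.mem _ h'
    · exact hg
  link j hj := by
    rw [if_pos (show j ≤ t by omega)]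
    split_ifs with h'
    · exact h.link j h'
    · rwa [show j = t by omega]
  disj i j hij hj := by
    rw [if_pos (show i ≤ t by omega)]
    split_ifs with h'
    · exact h.disj i j hij h'
    · exact h2 i (by omega)

/-- Exploring along a simple path. -/
theorem Exploration.walk {e : ℕ → E} {t : ℕ} (h : IsSimplePath V H e t) {s r q : ℕ}
    {X : Finset ℕ} (hX : Exploration V F H s r q X (e 0))
    (hX1 : ∀ j, 0 < j → j ≤ t → V (e j) ∩ X ⊆ V (e (j - 1))) {b : ℕ} (hb : b ≤ t) :
    ∃ Y : Finset ℕ, Exploration V F H (s + b) r q Y (e b) ∧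
      ∀ v, v ∈ Y ↔ v ∈ X ∨ ∃ j ≤ b, v ∈ V (e j) := by
  induction b with
  | zero =>
    refine ⟨X, hX, fun v => ⟨Or.inl, ?_⟩⟩
    rintro (h1 | ⟨j, hj, hv⟩)
    · exact h1
    · obtain rfl : j = 0 := by omega
      exact hX.last_subset hv
  | succ b ih =>
    obtain ⟨Y, hY, hYv⟩ := ih (by omega)
    have hl := h.link b (by omega)
    have key : V (e (b + 1)) ∩ Y = V (e (b + 1)) ∩ V (e b) := by
      ext v
      simp only [Finset.mem_inter, hYv]
      constructor
      · rintro ⟨h1, h2 | ⟨j, hj, h2⟩⟩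
        · exact ⟨h1, hX1 (b + 1) (by omega) hb (Finset.mem_inter.2 ⟨h1, h2⟩)⟩
        · rcases Nat.lt_or_ge j b with hjb | hjb
          · have := h.disj j (b + 1) (by omega) hb
            exact absurd (Finset.mem_inter.2 ⟨h1, h2⟩) (by simp [this])
          · obtain rfl : j = b := by omega
            exact ⟨h1, h2⟩
      · rintro ⟨h1, h2⟩
        exact ⟨h1, Or.inr ⟨b, le_rfl, h2⟩⟩
    refine ⟨Y ∪ V (e (b + 1)), ?_, ?_⟩
    · exact .ext hY _ (h.mem _ hb) (by rw [key, hl]) (Finset.card_pos.1 (by omega))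
    · intro v
      rw [Finset.mem_union, hYv]
      constructor
      · rintro ((h1 | ⟨j, hj, h1⟩) | h1)
        · exact Or.inl h1
        · exact Or.inr ⟨j, by omega, h1⟩
        · exact Or.inr ⟨b + 1, le_rfl, h1⟩
      · rintro (h1 | ⟨j, hj, h1⟩)
        · exact Or.inl (Or.inl h1)
        · rcases Nat.lt_or_ge j (b + 1) with hjb | hjb
          · exact Or.inl (Or.inr ⟨j, by omega, h1⟩)
          · obtain rfl : j = b + 1 := by omega
            exact Or.inr h1

/-- A simple path is an exploration without free steps. -/
theorem IsSimplePath.exploration {e : ℕ → E} {t : ℕ} (h : IsSimplePath V H e t)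
    (F : E → Finset ℕ → ℕ) :
    ∃ Y : Finset ℕ, Exploration V F H (1 + t) 0 0 Y (e t) ∧
      ∀ v, v ∈ Y ↔ ∃ j ≤ t, v ∈ V (e j) := by
  obtain ⟨Y, hY, hYv⟩ := Exploration.walk (F := F) h (.start (e 0) (h.mem 0 (by omega))) (by
    intro j hj hjt
    rcases Nat.lt_or_ge 1 j with h1 | h1
    · rw [h.disj 0 j (by omega) hjt]; simp
    · obtain rfl : j = 1 := by omega
      exact Finset.inter_subset_right) le_rfl
  refine ⟨Y, hY, fun v => ?_⟩
  rw [hYv]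
  exact ⟨fun h' => h'.elim (fun h'' => ⟨0, by omega, h''⟩) id, Or.inr⟩

/-! ### Sparse hypergraphs contain simple cycles -/

/-- A hypergraph in which every edge meets, at each of its vertices, another edge in that vertex
only, and in which explorations are cheap and simple paths are short. -/
structure IsSparse (V : E → Finset ℕ) (F : E → Finset ℕ → ℕ) (H : Set E) (k ℓ L : ℕ) : Prop where
  three_le : 3 ≤ k
  pos : 1 ≤ ℓ
  card : ∀ e ∈ H, (V e).card = k
  cost_pair : ∀ e ∈ H, ∀ I ⊆ V e, I.card = 2 → ℓ ≤ F e I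
  cost_pos : ∀ e ∈ H, ∀ I ⊆ V e, 2 ≤ I.card → I.card < k → 1 ≤ F e I
  -- The budget `ℓ` is the exponent of `y` gained by the first edge. The bounds on `s` and `r` leave
  -- room for a cycle, a path leaving it and two further edges.
  cheap : ∀ s r q X e, Exploration V F H s r q X e → s ≤ 2 * L + 10 → r ≤ 4 → q ≤ ℓ
  short : ∀ q X e, ¬ Exploration V F H (1 + L) 0 q X e
  private_edge : ∀ e ∈ H, ∀ v ∈ V e, ∃ e' ∈ H, V e' ∩ V e = {v}

variable {k ℓ L : ℕ}

theorem IsSparse.path_short (hS : IsSparse V F H k ℓ L) {e : ℕ → E} {t : ℕ}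
    (h : IsSimplePath V H e t) : t < L := by
  by_contra hlt
  obtain ⟨Y, hY, -⟩ := IsSimplePath.exploration (h.shift (i := 0) (t' := L) (by omega)) F
  exact hS.short _ _ _ hY

/-- A closing edge meets the first edge of a simple path in at most one vertex. -/
theorem IsSparse.card_inter_le_one (hS : IsSparse V F H k ℓ L) {e : ℕ → E} {t : ℕ}
    (h : IsSimplePath V H e t) (ht : 1 ≤ t) {g : E} (hg : g ∈ H) {v : ℕ}
    (hlast : V g ∩ V (e t) = {v}) (hv : v ∉ V (e 0))
    (hmid : ∀ j, 0 < j → j < t → V g ∩ V (e j) = ∅) : (V g ∩ V (e 0)).card ≤ 1 := by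
  -- Explore from `g`. Adding `e 0` costs at least 1, since it shares at least two but not all
  -- vertices with `g`. After walking to `e (t - 1)`, the edge `e t` meets the explored set in `v`
  -- and in its link, which costs `ℓ` more.
  by_contra hlt
  have hvg : v ∈ V g ∩ V (e t) := by simp [hlast]
  rw [Finset.mem_inter] at hvg
  have h0 := h.mem 0 (by omega)
  have hfat : 2 ≤ (V (e 0) ∩ V g).card := by rw [Finset.inter_comm]; omega
  have hnotfull : (V (e 0) ∩ V g).card < k := by
    rw [← hS.card g hg]
    refine Finset.card_lt_card ⟨Finset.inter_subset_right, fun hsub => hv ?_⟩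
    exact (Finset.mem_inter.1 (hsub hvg.1)).1
  have c1 := hS.cost_pos _ h0 _ Finset.inter_subset_left hfat hnotfull
  have x1 : Exploration V F H _ _ _ _ _ :=
    .free (.start (V := V) (F := F) g hg) (e 0) h0 (Finset.card_pos.1 (by omega))
  obtain ⟨Y, hY, hYv⟩ := Exploration.walk (h.shift (i := 0) (t' := t - 1) (by omega)) (by simpa using x1) (by
    intro j hj hjt v hv'
    simp only [zero_add, Finset.mem_inter, Finset.mem_union] at hv' ⊢
    rcases hv' with ⟨h1, h2 | h2⟩
    · have := hmid j hj (by omega)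
      exact absurd (Finset.mem_inter.2 ⟨h2, h1⟩) (by simp [this])
    · rcases Nat.lt_or_ge 1 j with hj1 | hj1
      · have := h.disj 0 j (by omega) (by omega)
        exact absurd (Finset.mem_inter.2 ⟨h1, h2⟩) (by simp [this])
      · obtain rfl : j = 1 := by omega
        exact h2) le_rfl
  have hYe : V (e t) ∩ Y = {v} ∪ (V (e t) ∩ V (e (t - 1))) := by
    ext z
    simp only [Finset.mem_inter, hYv, Finset.mem_union, Finset.mem_singleton, zero_add]
    constructor
    · rintro ⟨h1, (h2 | h2) | ⟨j, hj, h2⟩⟩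
      · left
        have : z ∈ V g ∩ V (e t) := Finset.mem_inter.2 ⟨h2, h1⟩
        simpa [hlast] using this
      · right
        rcases Nat.lt_or_ge 1 t with hj1 | hj1
        · have := h.disj 0 t (by omega) (by omega)
          exact absurd (Finset.mem_inter.2 ⟨h1, h2⟩) (by simp [this])
        · obtain rfl : t = 1 := by omega
          exact ⟨h1, h2⟩
      · right
        rcases Nat.lt_or_ge j (t - 1) with hj1 | hj1
        · have := h.disj j t (by omega) (by omega)
          exact absurd (Finset.mem_inter.2 ⟨h1, h2⟩) (by simp [this])
        · obtain rfl : j = t - 1 := by omega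
          exact ⟨h1, h2⟩
    · rintro (rfl | ⟨h1, h2⟩)
      · exact ⟨hvg.2, Or.inl (Or.inl hvg.1)⟩
      · exact ⟨h1, Or.inr ⟨t - 1, le_rfl, h2⟩⟩
  have hvt : v ∉ V (e (t - 1)) := by
    rcases Nat.lt_or_ge 1 t with hj1 | hj1
    · intro hv'
      have := hmid (t - 1) (by omega) (by omega)
      exact absurd (Finset.mem_inter.2 ⟨hvg.1, hv'⟩) (by simp [this])
    · obtain rfl : t = 1 := by omega
      exact hv
  have hl := h.link (t - 1) (by omega)
  rw [show t - 1 + 1 = t by omega] at hl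
  have hcard : (V (e t) ∩ Y).card = 2 := by
    rw [hYe, Finset.card_union_of_disjoint, hl]
    · simp
    · simp [hvt]
  have x2 := hY.free (e t) (h.mem t le_rfl) (Finset.card_pos.1 (by omega))
  have c2 := hS.cost_pair _ (h.mem t le_rfl) _ Finset.inter_subset_left hcard
  have := hS.path_short h
  have := hS.cheap _ _ _ _ _ x2 (by omega) (by omega)
  omega

theorem IsSparse.exists_longest_path (hS : IsSparse V F H k ℓ L) {P : (ℕ → E) → ℕ → Prop}
    (hP : ∀ e t, P e t → IsSimplePath V H e t) (hne : ∃ e t, P e t) :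
    ∃ e t, P e t ∧ ∀ e' t', P e' t' → t' ≤ t := by
  classical
  obtain ⟨e₀, t₀, h₀⟩ := hne
  have hb : ∀ t, (∃ e, P e t) → t ≤ L := fun t ⟨e, he⟩ => (hS.path_short (hP e t he)).le
  have hm := Nat.findGreatest_spec (P := fun t => ∃ e, P e t) (hb _ ⟨e₀, h₀⟩) ⟨e₀, h₀⟩
  obtain ⟨e, he⟩ := hm
  exact ⟨e, _, he, fun e' t' h' => Nat.le_findGreatest (hb _ ⟨e', h'⟩) ⟨e', h'⟩⟩

/-- The last edge of a longest simple path has a vertex off the earlier edges. The private edge at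
this vertex cannot extend the path, so it runs back into it; the part of the path from the last
earlier edge it meets is closed by it to a cycle. -/
theorem IsSparse.exists_cycle (hS : IsSparse V F H k ℓ L) (hne : H.Nonempty) :
    ∃ e t g a b, IsSimpleCycle V H e t g a b := by
  obtain ⟨e₀, he₀⟩ := hne
  have h3 := hS.three_le
  obtain ⟨e, t, h, hmax⟩ := hS.exists_longest_path (P := IsSimplePath V H) (fun _ _ h => h)
    ⟨fun _ => e₀, 0, ⟨fun _ _ => he₀, fun i hi => by omega, fun i j hi hj => by omega⟩⟩
  have het := h.mem t le_rfl
  obtain ⟨v, hv, hv'⟩ : ∃ v ∈ V (e t), ∀ j < t, v ∉ V (e j) := by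
    rcases Nat.eq_zero_or_pos t with rfl | ht
    · obtain ⟨v, hv⟩ := Finset.card_pos.1 (show 0 < (V (e 0)).card by rw [hS.card _ het]; omega)
      exact ⟨v, hv, by simp⟩
    · have hl := h.link (t - 1) (by omega)
      rw [show t - 1 + 1 = t by omega] at hl
      obtain ⟨v, hv, hvn⟩ : ∃ v ∈ V (e t), v ∉ V (e t) ∩ V (e (t - 1)) :=
        Finset.exists_mem_notMem_of_card_lt_card (by rw [hS.card _ het]; omega)
      refine ⟨v, hv, fun j hj hvj => ?_⟩
      rcases Nat.lt_or_ge j (t - 1) with hj1 | hj1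
      · have := h.disj j t (by omega) le_rfl
        exact absurd (Finset.mem_inter.2 ⟨hv, hvj⟩) (by simp [this])
      · obtain rfl : j = t - 1 := by omega
        exact hvn (Finset.mem_inter.2 ⟨hv, hvj⟩)
  obtain ⟨g, hg, hgv⟩ := hS.private_edge _ het v hv
  have hex : ∃ j < t, (V g ∩ V (e j)).Nonempty := by
    by_contra hcon
    push Not at hcon
    have := hmax _ _ (h.append hg (by simp [hgv]) hcon)
    omega
  obtain ⟨i, ⟨hit, hi⟩, himax⟩ : ∃ i, (i < t ∧ (V g ∩ V (e i)).Nonempty) ∧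
      ∀ j, i < j → j < t → V g ∩ V (e j) = ∅ := by
    classical
    obtain ⟨j, hj, hj'⟩ := hex
    have hspec := Nat.findGreatest_spec (P := fun j => j < t ∧ (V g ∩ V (e j)).Nonempty)
      hj.le ⟨hj, hj'⟩
    refine ⟨_, hspec, fun j' h1 h2 => ?_⟩
    by_contra hcon
    exact Nat.findGreatest_is_greatest h1 h2.le ⟨h2, Finset.nonempty_iff_ne_empty.2 hcon⟩
  have hp := h.shift (i := i) (t' := t - i) (by omega)
  have hit' : i + (t - i) = t := by omega
  have hcard := hS.card_inter_le_one hp (by omega) hg (v := v) (by simpa [hit'] using hgv)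
    (by simpa using hv' i hit) (fun j h1 h2 => himax _ (by omega) (by omega))
  obtain ⟨a, ha⟩ := Finset.card_eq_one.1 (le_antisymm hcard (by simpa using Finset.card_pos.2 hi))
  refine ⟨_, t - i, g, a, v, hp, by omega, hg, ha, by simpa [hit'] using hgv, ?_,
    fun j h1 h2 => himax _ (by omega) (by omega)⟩
  rintro rfl
  have : a ∈ V g ∩ V (e (i + 0)) := by rw [ha]; simp
  exact hv' i hit (by simpa using (Finset.mem_inter.1 this).2)

end RadoHypergraph

/-! ### The neighbourhood of a cycle, and shortest cycles -/

namespace RadoHypergraph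

variable {E : Type*} {V : E → Finset ℕ} {F : E → Finset ℕ → ℕ} {H : Set E} {k ℓ L : ℕ}

theorem IsSimpleCycle.rev {e : ℕ → E} {t : ℕ} {g : E} {a b : ℕ}
    (h : IsSimpleCycle V H e t g a b) : IsSimpleCycle V H (fun j => e (t - j)) t g b a where
  path := h.path.rev
  pos := h.pos
  mem := h.mem
  first := by simpa using h.last
  last := by simpa using h.first
  ne := h.ne.symm
  mid j h1 h2 := h.mid _ (by omega) (by omega)

/-- The vertices of a simple cycle can be explored at cost at least `ℓ`. -/
theorem IsSparse.exploration_cycle (hS : IsSparse V F H k ℓ L) {e : ℕ → E} {t : ℕ} {g : E}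
    {a b : ℕ} (h : IsSimpleCycle V H e t g a b) :
    ∃ q T, Exploration V F H (t + 2) 1 q T g ∧ ℓ ≤ q ∧
      ∀ v, v ∈ T ↔ v ∈ V g ∨ ∃ j ≤ t, v ∈ V (e j) := by
  obtain ⟨Y, hY, hYv⟩ := h.path.exploration F
  have hpos := h.pos
  have key : V g ∩ Y = {a, b} := by
    ext v
    have h1 := Finset.ext_iff.1 h.first v
    have h2 := Finset.ext_iff.1 h.last v
    simp only [Finset.mem_inter, Finset.mem_singleton, hYv, Finset.mem_insert] at h1 h2 ⊢
    rw [← h1, ← h2]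
    constructor
    · rintro ⟨h3, j, hj, h4⟩
      rcases Nat.eq_zero_or_pos j with rfl | hj0
      · exact Or.inl ⟨h3, h4⟩
      · rcases Nat.lt_or_ge j t with hjt | hjt
        · exact absurd (Finset.mem_inter.2 ⟨h3, h4⟩) (by simp [h.mid j hj0 hjt])
        · obtain rfl : j = t := by omega
          exact Or.inr ⟨h3, h4⟩
    · rintro (⟨h3, h4⟩ | ⟨h3, h4⟩)
      · exact ⟨h3, 0, by omega, h4⟩
      · exact ⟨h3, t, le_rfl, h4⟩
  have hc : (V g ∩ Y).card = 2 := by rw [key, Finset.card_pair h.ne]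
  have x := hY.free g h.mem (Finset.card_pos.1 (by omega))
  rw [show 1 + t + 1 = t + 2 by omega] at x
  refine ⟨_, _, x, ?_, fun v => ?_⟩
  · have := hS.cost_pair g h.mem _ Finset.inter_subset_left hc
    omega
  · rw [Finset.mem_union, hYv, or_comm]

/-- Every edge that meets a simple cycle is contained in it. -/
theorem IsSparse.subset_of_inter_cycle (hS : IsSparse V F H k ℓ L) {e : ℕ → E} {t : ℕ} {g : E}
    {a b : ℕ} (h : IsSimpleCycle V H e t g a b) {T : Finset ℕ}
    (hT : ∀ v, v ∈ T ↔ v ∈ V g ∨ ∃ j ≤ t, v ∈ V (e j)) {z : E} (hz : z ∈ H)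
    (hzT : (V z ∩ T).Nonempty) : V z ⊆ T := by
  obtain ⟨q, T', hexp, hq, hT'⟩ := hS.exploration_cycle h
  obtain rfl : T = T' := by ext v; rw [hT, hT']
  have h3 := hS.three_le
  have htL := hS.path_short h.path
  -- The cycle has used up the budget, so an edge that leaves `T` cannot afford to meet it twice.
  have single : ∀ f ∈ H, (V f ∩ T).Nonempty → ¬ V f ⊆ T → (V f ∩ T).card = 1 := by
    intro f hf hne hsub
    have hpos := Finset.card_pos.2 hne
    by_contra hcon
    have hlt : (V f ∩ T).card < k := by
      rw [← hS.card f hf]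
      refine Finset.card_lt_card ⟨Finset.inter_subset_left, fun hs => hsub fun x hx => ?_⟩
      exact (Finset.mem_inter.1 (hs hx)).2
    have c := hS.cost_pos f hf _ Finset.inter_subset_left (by omega) hlt
    have := hS.cheap _ _ _ _ _ (hexp.free f hf hne) (by omega) (by omega)
    omega
  by_contra hsub
  obtain ⟨f, r, ⟨hf, hf0, hfT⟩, hmax⟩ := hS.exists_longest_path
    (P := fun f r => IsSimplePath V H f r ∧ (V (f 0) ∩ T).card = 1 ∧
      ∀ j, 0 < j → j ≤ r → V (f j) ∩ T = ∅) (fun _ _ h => h.1)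
    ⟨fun _ => z, 0, ⟨fun _ _ => hz, fun i hi => by omega, fun i j hi hj => by omega⟩,
      single z hz hzT hsub, fun j h1 h2 => by omega⟩
  have hrL := hS.path_short hf
  -- X is the set explored before the last edge of the path
  obtain ⟨X, s, q', r', x, hxX, hs, hr', hqq⟩ : ∃ X s q' r', ∃ x, Exploration V F H s r' q' X x ∧
      (∀ v, v ∈ X ↔ v ∈ T ∨ ∃ j < r, v ∈ V (f j)) ∧ s ≤ t + 2 + r ∧ r' ≤ 2 ∧ ℓ ≤ q' := by
    rcases Nat.eq_zero_or_pos r with rfl | hr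
    · exact ⟨T, _, _, _, _, hexp, by simp, by omega, by omega, hq⟩
    -- This step has to be free: `f 0` meets `T`, but perhaps not in the last edge `g`.
    · have x0 := hexp.free (f 0) (hf.mem 0 (by omega)) (Finset.card_pos.1 (by omega))
      obtain ⟨Y, hY, hYv⟩ := x0.walk (hf.shift (i := 0) (t' := r - 1) (by omega)) (by
        intro j hj hjt v hv'
        simp only [zero_add, Finset.mem_inter, Finset.mem_union] at hv' ⊢
        rcases hv' with ⟨h1, h2 | h2⟩
        · exact absurd (Finset.mem_inter.2 ⟨h1, h2⟩) (by simp [hfT j hj (by omega)])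
        · rcases Nat.lt_or_ge 1 j with hj1 | hj1
          · have := hf.disj 0 j (by omega) (by omega)
            exact absurd (Finset.mem_inter.2 ⟨h1, h2⟩) (by simp [this])
          · obtain rfl : j = 1 := by omega
            exact h2) le_rfl
      refine ⟨Y, _, _, _, _, hY, fun v => ?_, by omega, by omega, by omega⟩
      rw [hYv, Finset.mem_union]
      simp only [zero_add]
      constructor
      · rintro ((h1 | h1) | ⟨j, hj, h1⟩)
        · exact Or.inl h1
        · exact Or.inr ⟨0, hr, h1⟩
        · exact Or.inr ⟨j, by omega, h1⟩
      · rintro (h1 | ⟨j, hj, h1⟩)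
        · exact Or.inl (Or.inl h1)
        · exact Or.inr ⟨j, by omega, h1⟩
  have hfr := hf.mem r le_rfl
  have hcardX : (V (f r) ∩ X).card = 1 := by
    rcases Nat.eq_zero_or_pos r with rfl | hr
    · rwa [show X = T by ext v; simp [hs]]
    · have hl := hf.link (r - 1) (by omega)
      rw [show r - 1 + 1 = r by omega] at hl
      rw [← hl]
      congr 1
      ext v
      simp only [Finset.mem_inter, hs]
      constructor
      · rintro ⟨h1, h2 | ⟨j, hj, h2⟩⟩
        · exact absurd (Finset.mem_inter.2 ⟨h1, h2⟩) (by simp [hfT r hr le_rfl])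
        · rcases Nat.lt_or_ge j (r - 1) with hj1 | hj1
          · have := hf.disj j r (by omega) le_rfl
            exact absurd (Finset.mem_inter.2 ⟨h1, h2⟩) (by simp [this])
          · obtain rfl : j = r - 1 := by omega
            exact ⟨h1, h2⟩
      · rintro ⟨h1, h2⟩
        exact ⟨h1, Or.inr ⟨r - 1, by omega, h2⟩⟩
  obtain ⟨v, hv, hvX⟩ : ∃ v ∈ V (f r), v ∉ V (f r) ∩ X :=
    Finset.exists_mem_notMem_of_card_lt_card (by rw [hS.card _ hfr]; omega)
  have hvX' : v ∉ X := fun h' => hvX (Finset.mem_inter.2 ⟨hv, h'⟩)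
  obtain ⟨y, hy, hyv⟩ := hS.private_edge _ hfr v hv
  have hvy : v ∈ V y := by
    have : v ∈ V y ∩ V (f r) := by simp [hyv]
    exact (Finset.mem_inter.1 this).1
  -- Otherwise `y` would prolong the longest path.
  have hyX : (V y ∩ X).Nonempty := by
    by_contra hcon
    rw [Finset.not_nonempty_iff_eq_empty] at hcon
    have hno : ∀ u ∈ V y, u ∉ X := fun u h1 h2 =>
      absurd (Finset.mem_inter.2 ⟨h1, h2⟩) (by simp [hcon])
    have happ := hf.append hy (by simp [hyv]) (fun j hj => Finset.eq_empty_of_forall_notMem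
      fun u hu => hno u (Finset.mem_inter.1 hu).1 ((hs u).2 (Or.inr ⟨j, hj, (Finset.mem_inter.1 hu).2⟩)))
    have := hmax _ _ ⟨happ, by simpa using hf0, fun j h1 h2 => by
      split_ifs with h'
      · exact hfT j h1 h'
      · exact Finset.eq_empty_of_forall_notMem fun u hu => hno u (Finset.mem_inter.1 hu).1
          ((hs u).2 (Or.inl (Finset.mem_inter.1 hu).2))⟩
    omega
  have hylt : (V y ∩ X).card < k := by
    rw [← hS.card y hy]
    exact Finset.card_lt_card ⟨Finset.inter_subset_left, fun hs' =>
      hvX' (Finset.mem_inter.1 (hs' hvy)).2⟩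
  have x1 := hxX.free y hy hyX
  -- Either `y` meets `X` at least twice and itself costs something, or `y` is added first and then
  -- `f r` meets the explored set in two vertices, one in `X` and the other `v`. This uses up to
  -- four free steps.
  rcases Nat.lt_or_ge 1 (V y ∩ X).card with h2 | h2
  · have c := hS.cost_pos y hy _ Finset.inter_subset_left h2 hylt
    have := hS.cheap _ _ _ _ _ x1 (by omega) (by omega)
    omega
  · have hunion : V (f r) ∩ (X ∪ V y) = (V (f r) ∩ X) ∪ {v} := by
      rw [Finset.inter_union_distrib_left, Finset.inter_comm _ (V y), hyv]
    have hc2 : (V (f r) ∩ (X ∪ V y)).card = 2 := by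
      rw [hunion, Finset.card_union_of_disjoint (by simp [hvX']), hcardX, Finset.card_singleton]
    have c := hS.cost_pair _ hfr _ Finset.inter_subset_left hc2
    have h1 := hS.pos
    have := hS.cheap _ _ _ _ _ (x1.free (f r) hfr (Finset.card_pos.1 (by omega)))
      (by omega) (by omega)
    omega

/-- An edge `z` meeting the closing edge of a simple cycle in one vertex off the path closes off a
second cycle through the first edge of the path it meets. -/
theorem IsSparse.cut_cycle (hS : IsSparse V F H k ℓ L) {e : ℕ → E} {t : ℕ} {g : E}
    {a b : ℕ} (h : IsSimpleCycle V H e t g a b) {z : E} (hz : z ∈ H) {w : ℕ}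
    (hzg : V z ∩ V g = {w}) (hw : ∀ j ≤ t, w ∉ V (e j)) {i : ℕ} (hi : i < t)
    (hmeet : (V z ∩ V (e i)).Nonempty) (hmin : ∀ j < i, V z ∩ V (e j) = ∅) :
    ∃ x, V z ∩ V (e i) = {x} ∧ ∃ f, IsSimpleCycle V H f (i + 1) z x w := by
  -- The new cycle runs through `e i`, …, `e 0`, `g` and is closed by `z`.
  have hp := (h.path.shift (i := 0) (t' := i) (by omega)).rev
  have hga : V g ∩ V (e (0 + (i - i))) = {a} := by simpa using h.first
  have hp' := hp.append (g := g) h.mem (by rw [hga]; simp) (fun j hj => h.mid _ (by omega) (by omega))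
  have hmid' : ∀ j, 0 < j → j < i + 1 →
      V z ∩ V (if j ≤ i then e (0 + (i - j)) else g) = ∅ := by
    intro j h1 h2
    rw [if_pos (by omega)]
    exact hmin _ (by omega)
  have hcard := hS.card_inter_le_one hp' (by omega) hz (v := w) (by simpa using hzg)
    (by simpa using hw i hi.le) hmid'
  simp only [zero_le, if_true, zero_add, Nat.sub_zero] at hcard
  obtain ⟨x, hx⟩ := Finset.card_eq_one.1 (le_antisymm hcard (by simpa using Finset.card_pos.2 hmeet))
  refine ⟨x, hx, _, hp', by omega, hz, by simpa using hx, by simpa using hzg, ?_, hmid'⟩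
  rintro rfl
  have : x ∈ V z ∩ V (e i) := by rw [hx]; simp
  exact hw i hi.le (Finset.mem_inter.1 this).2

/-- A nonempty sparse hypergraph has uniformity three and contains a triangle `e₀, e₁, g` such that
all edges meeting the triangle are contained in it. -/
theorem IsSparse.exists_triangle (hS : IsSparse V F H k ℓ L) (hne : H.Nonempty) :
    k = 3 ∧ ∃ e g a b, IsSimpleCycle V H e 1 g a b := by
  classical
  have hex : ∃ t, ∃ e g a b, IsSimpleCycle V H e t g a b := by
    obtain ⟨e, t, g, a, b, h⟩ := hS.exists_cycle hne
    exact ⟨t, e, g, a, b, h⟩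
  obtain ⟨e, g, a, b, h⟩ := Nat.find_spec hex
  have hmin : ∀ t', (∃ e g a b, IsSimpleCycle V H e t' g a b) → Nat.find hex ≤ t' :=
    fun t' h' => Nat.find_min' hex h'
  set t := Nat.find hex with ht
  clear_value t
  have htpos := h.pos
  have h3 := hS.three_le
  obtain ⟨w, hwg, hwab⟩ : ∃ w ∈ V g, w ∉ ({a, b} : Finset ℕ) :=
    Finset.exists_mem_notMem_of_card_lt_card (by
      rw [hS.card _ h.mem, Finset.card_pair h.ne]; omega)
  have hw : ∀ j ≤ t, w ∉ V (e j) := by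
    intro j hj hwj
    have hm := Finset.mem_inter.2 ⟨hwg, hwj⟩
    simp only [Finset.mem_insert, Finset.mem_singleton, not_or] at hwab
    rcases Nat.eq_zero_or_pos j with rfl | hj0
    · rw [h.first] at hm; exact hwab.1 (by simpa using hm)
    · rcases Nat.lt_or_ge j t with hjt | hjt
      · rw [h.mid j hj0 hjt] at hm; simp at hm
      · obtain rfl : j = t := by omega
        rw [h.last] at hm; exact hwab.2 (by simpa using hm)
  obtain ⟨z, hz, hzg⟩ := hS.private_edge g h.mem w hwg
  have hwz : w ∈ V z := by
    have : w ∈ V z ∩ V g := by simp [hzg]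
    exact (Finset.mem_inter.1 this).1
  have hzT : ∀ v ∈ V z, v ≠ w → ∃ j ≤ t, v ∈ V (e j) := by
    obtain ⟨q, T, -, -, hT⟩ := hS.exploration_cycle h
    have hsub := hS.subset_of_inter_cycle h hT hz ⟨w, Finset.mem_inter.2 ⟨hwz, (hT w).2 (Or.inl hwg)⟩⟩
    intro v hv hvw
    rcases (hT v).1 (hsub hv) with h1 | h1
    · have : v ∈ V z ∩ V g := Finset.mem_inter.2 ⟨hv, h1⟩
      rw [hzg] at this
      exact absurd (by simpa using this) hvw
    · exact h1
  have hmeet : ∃ i, i ≤ t ∧ (V z ∩ V (e i)).Nonempty := by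
    obtain ⟨v, hv, hvw⟩ : ∃ v ∈ V z, v ∉ ({w} : Finset ℕ) :=
      Finset.exists_mem_notMem_of_card_lt_card (by rw [hS.card _ hz]; simp; omega)
    obtain ⟨j, hj, hvj⟩ := hzT v hv (by simpa using hvw)
    exact ⟨j, hj, v, Finset.mem_inter.2 ⟨hv, hvj⟩⟩
  obtain ⟨i, ⟨hi, hine⟩, himin⟩ : ∃ i, (i ≤ t ∧ (V z ∩ V (e i)).Nonempty) ∧
      ∀ j < i, V z ∩ V (e j) = ∅ := by
    refine ⟨Nat.find hmeet, Nat.find_spec hmeet, fun j hj => ?_⟩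
    by_contra hcon
    have := (Nat.find_spec hmeet).1
    exact Nat.find_min hmeet hj ⟨by omega, Finset.nonempty_iff_ne_empty.2 hcon⟩
  have hmeet' : ∃ i, i ≤ t ∧ (V z ∩ V (e (t - i))).Nonempty :=
    ⟨t - i, by omega, by rwa [show t - (t - i) = i by omega]⟩
  obtain ⟨i', ⟨hi', hine'⟩, himin'⟩ : ∃ i, (i ≤ t ∧ (V z ∩ V (e (t - i))).Nonempty) ∧
      ∀ j < i, V z ∩ V (e (t - j)) = ∅ := by
    refine ⟨Nat.find hmeet', Nat.find_spec hmeet', fun j hj => ?_⟩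
    by_contra hcon
    have := (Nat.find_spec hmeet').1
    exact Nat.find_min hmeet' hj ⟨by omega, Finset.nonempty_iff_ne_empty.2 hcon⟩
  -- `cut_cycle` gives a cycle of parameter `i + 1`, which by minimality is not below `t`; `hback`
  -- is the same from the other end.
  have hforw : i < t → i + 1 ≥ t ∧ (V z ∩ V (e i)).card = 1 := by
    intro hit
    obtain ⟨x, hx, f, hf⟩ := hS.cut_cycle h hz hzg hw hit hine himin
    exact ⟨hmin _ ⟨f, z, x, w, hf⟩, by rw [hx]; simp⟩
  have hback : i' < t → i' + 1 ≥ t ∧ (V z ∩ V (e (t - i'))).card = 1 := by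
    intro hit
    obtain ⟨x, hx, f, hf⟩ := hS.cut_cycle h.rev hz hzg (fun j hj => hw _ (by omega)) hit hine' himin'
    exact ⟨hmin _ ⟨f, z, x, w, hf⟩, by rw [hx]; simp⟩
  have hrange : ∀ v ∈ V z, v ≠ w → ∃ j, i ≤ j ∧ j ≤ t - i' ∧ v ∈ V (e j) := by
    intro v hv hvw
    obtain ⟨j, hj, hvj⟩ := hzT v hv hvw
    refine ⟨j, ?_, ?_, hvj⟩
    · by_contra hcon
      exact absurd (Finset.mem_inter.2 ⟨hv, hvj⟩) (by simp [himin j (by omega)])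
    · by_contra hcon
      have := himin' (t - j) (by omega)
      rw [show t - (t - j) = j by omega] at this
      exact absurd (Finset.mem_inter.2 ⟨hv, hvj⟩) (by simp [this])
  have hcov : V z ⊆ {w} ∪ ((V z ∩ V (e i)) ∪ (V z ∩ V (e (t - i')))) →
      (V z ∩ V (e i)).card = 1 → (V z ∩ V (e (t - i'))).card = 1 → k = 3 := by
    intro h1 h2 h4
    have := (Finset.card_le_card h1).trans ((Finset.card_union_le _ _).trans
      (Nat.add_le_add_left (Finset.card_union_le _ _) _))
    rw [hS.card _ hz, h2, h4, Finset.card_singleton] at this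
    omega
  -- If `z` meets two path edges, the two bounds give `t = 1`, and `z` consists of `w` and one
  -- vertex on each. If it meets only one, `z` has at most two vertices, which is too few.
  rcases Nat.lt_or_ge i (t - i') with hlt | hge
  · obtain ⟨h1, h2⟩ := hforw (by omega)
    obtain ⟨h4, h5⟩ := hback (by omega)
    have ht1 : t = 1 := by omega
    refine ⟨hcov ?_ h2 h5, ?_⟩
    · intro v hv
      by_cases hvw : v = w
      · simp [hvw]
      · obtain ⟨j, hj1, hj2, hvj⟩ := hrange v hv hvw
        obtain rfl | rfl : j = i ∨ j = t - i' := by omega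
        all_goals simp [hv, hvj]
    · rw [ht1] at h
      exact ⟨e, g, a, b, h⟩
  · exfalso
    have hsub : V z ⊆ {w} ∪ (V z ∩ V (e i)) := by
      intro v hv
      by_cases hvw : v = w
      · simp [hvw]
      · obtain ⟨j, hj1, hj2, hvj⟩ := hrange v hv hvw
        obtain rfl : j = i := by omega
        simp [hv, hvj]
    have hle := (Finset.card_le_card hsub).trans (Finset.card_union_le _ _)
    rw [hS.card _ hz, Finset.card_singleton] at hle
    have hii : i = t - i' := by
      obtain ⟨v, hv, hvw⟩ : ∃ v ∈ V z, v ∉ ({w} : Finset ℕ) :=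
        Finset.exists_mem_notMem_of_card_lt_card (by rw [hS.card _ hz]; simp; omega)
      obtain ⟨j, hj1, hj2, -⟩ := hrange v hv (by simpa using hvw)
      omega
    rcases Nat.lt_or_ge i t with hit | hit
    · have := (hforw hit).2
      omega
    · have := (hback (by omega)).2
      rw [← hii] at this
      omega

/-! ### Minimal unavoidable families -/

/-- `H` is a family of coloured edges such that every colouring makes some edge monochromatic in its
own colour. -/
def IsUnavoidable (V : E → Finset ℕ) (col : E → Fin 2) (H : Set E) : Prop :=
  ∀ χ : ℕ → Fin 2, ∃ e ∈ H, ∀ v ∈ V e, χ v = col e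

/-- In a minimal unavoidable family every edge has, at each vertex, another edge meeting it only
there. -/
theorem exists_inter_eq_singleton {col : E → Fin 2} (hH : IsUnavoidable V col H)
    (hmin : ∀ e ∈ H, ¬ IsUnavoidable V col (H \ {e})) {e : E} (he : e ∈ H) {v : ℕ}
    (hv : v ∈ V e) : ∃ e' ∈ H, V e' ∩ V e = {v} := by
  have h1 := hmin e he
  unfold IsUnavoidable at h1
  push Not at h1
  obtain ⟨χ, hχ⟩ := h1
  have hχe : ∀ v ∈ V e, χ v = col e := by
    obtain ⟨e', he', h'⟩ := hH χ
    by_cases hee : e' = e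
    · rwa [← hee]
    · obtain ⟨v, hv, hv'⟩ := hχ e' ⟨he', hee⟩
      exact absurd (h' v hv) hv'
  -- Before `v` is flipped, `e` is the only edge monochromatic in its own colour. The edge completed
  -- by the flip has the opposite colour, so it shares with `e` only the vertex `v`.
  obtain ⟨e', he', h'⟩ := hH (Function.update χ v (1 - col e))
  have hne : (1 - col e) ≠ col e := by
    generalize col e = c
    revert c; decide
  have hee : e' ≠ e := by
    rintro rfl
    have := h' v hv
    simp only [Function.update_self] at this
    exact hne this
  have hve' : v ∈ V e' := by
    by_contra hcon
    obtain ⟨u, hu, hu'⟩ := hχ e' ⟨he', hee⟩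
    have := h' u hu
    rw [Function.update_of_ne (by rintro rfl; exact hcon hu)] at this
    exact hu' this
  have hc := h' v hve'
  rw [Function.update_self] at hc
  refine ⟨e', he', Finset.eq_singleton_iff_unique_mem.2 ⟨Finset.mem_inter.2 ⟨hve', hv⟩, ?_⟩⟩
  intro u hu
  rw [Finset.mem_inter] at hu
  by_contra huv
  have := h' u hu.1
  rw [Function.update_of_ne huv, hχe u hu.2, ← hc] at this
  exact hne this.symm

/-- A minimal unavoidable family is not sparse. -/
theorem IsSparse.not_minimal (hS : IsSparse V F H k ℓ L) {col : E → Fin 2}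
    (hH : IsUnavoidable V col H) (hmin : ∀ e ∈ H, ¬ IsUnavoidable V col (H \ {e})) : False := by
  obtain ⟨hk, e, g, a, b, h⟩ := hS.exists_triangle (by
    obtain ⟨e, he, -⟩ := hH 0
    exact ⟨e, he⟩)
  subst hk
  obtain ⟨-, T, -, -, hT⟩ := hS.exploration_cycle h
  have hin := fun z hz => hS.subset_of_inter_cycle h hT (z := z) hz
  have he0 := h.path.mem 0 (by omega)
  have he1 := h.path.mem 1 (by omega)
  have hpos := hS.pos
  obtain ⟨y, hy⟩ := Finset.card_eq_one.1 (h.path.link 0 (by omega))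
  rw [zero_add] at hy
  have hy' : y ∈ V (e 1) ∩ V (e 0) := by rw [hy]; simp
  rw [Finset.mem_inter] at hy'
  have ha' : a ∈ V g ∩ V (e 0) := by rw [h.first]; simp
  have hb' : b ∈ V g ∩ V (e 1) := by rw [h.last]; simp
  rw [Finset.mem_inter] at ha' hb'
  obtain ⟨w, hwg, hwab⟩ : ∃ w ∈ V g, w ∉ ({a, b} : Finset ℕ) :=
    Finset.exists_mem_notMem_of_card_lt_card (by
      rw [hS.card _ h.mem, Finset.card_pair h.ne]; omega)
  have hgset : ({w, a, b} : Finset ℕ) = V g := by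
    refine Finset.eq_of_subset_of_card_le ?_ ?_
    · intro x; simp only [Finset.mem_insert, Finset.mem_singleton]
      rintro (rfl | rfl | rfl)
      exacts [hwg, ha'.1, hb'.1]
    · rw [hS.card _ h.mem, Finset.card_insert_of_notMem hwab, Finset.card_pair h.ne]
  have hTsub : ∀ v ∈ T, v ≠ w → v ∈ V (e 0) ∨ v ∈ V (e 1) := by
    intro v hv hvw
    rcases (hT v).1 hv with h1 | ⟨j, hj, h1⟩
    · rw [← hgset] at h1
      simp only [Finset.mem_insert, Finset.mem_singleton] at h1
      rcases h1 with rfl | rfl | rfl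
      · exact absurd rfl hvw
      · exact Or.inl ha'.2
      · exact Or.inr hb'.2
    · obtain rfl | rfl : j = 0 ∨ j = 1 := by omega
      · exact Or.inl h1
      · exact Or.inr h1
  -- two edges sharing two vertices and a third edge sharing one vertex with each
  have clash : ∀ p q z, p ∈ H → q ∈ H → z ∈ H → V q ∩ V p = {y} → y ∉ V z →
      (V z ∩ V p).card = 2 → (V z ∩ V q).card = 1 → False := by
    intro p q z hp hq hz hpq hyz h2 h1
    have x1 := (Exploration.start (V := V) (F := F) p hp).free z hz (Finset.card_pos.1 (by omega))
    have c1 := hS.cost_pair z hz _ Finset.inter_subset_left h2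
    have hcard : (V q ∩ (V p ∪ V z)).card = 2 := by
      rw [Finset.inter_union_distrib_left, hpq, Finset.card_union_of_disjoint,
        Finset.inter_comm (V q), h1]
      · simp
      · simp [hyz]
    have c2 := hS.cost_pair q hq _ Finset.inter_subset_left hcard
    have := hS.cheap _ _ _ _ _ (x1.free q hq (Finset.card_pos.1 (by omega))) (by omega) (by omega)
    omega
  -- Colour `y` and `w` alike and the rest of `T` oppositely. An edge avoiding both `y` and `w` has
  -- three vertices in `e 0` and `e 1`, hence two on one of them and one on the other, and `clash`
  -- finds cost at least `2 * ℓ`.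
  have hcol : ∀ z ∈ H, V z ⊆ T → (∀ v ∈ V z, v = y ∨ v = w) ∨ (∀ v ∈ V z, v ≠ y ∧ v ≠ w) → False := by
    intro z hz hzT hc
    have hzc := hS.card z hz
    rcases hc with hc | hc
    · have : V z ⊆ {y, w} := fun v hv => by simpa using hc v hv
      have := (Finset.card_le_card this).trans (Finset.card_le_two)
      omega
    · have hyz : y ∉ V z := fun h' => (hc y h').1 rfl
      have hzu : V z = (V z ∩ V (e 0)) ∪ (V z ∩ V (e 1)) := by
        ext v
        simp only [Finset.mem_union, Finset.mem_inter]
        constructor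
        · intro hv
          have := hTsub v (hzT hv) (hc v hv).2
          tauto
        · tauto
      have hdis : Disjoint (V z ∩ V (e 0)) (V z ∩ V (e 1)) := by
        rw [Finset.disjoint_left]
        intro v hv0 hv1
        rw [Finset.mem_inter] at hv0 hv1
        have : v ∈ V (e 1) ∩ V (e 0) := Finset.mem_inter.2 ⟨hv1.2, hv0.2⟩
        rw [hy, Finset.mem_singleton] at this
        exact hyz (this ▸ hv0.1)
      have hsum : (V z ∩ V (e 0)).card + (V z ∩ V (e 1)).card = 3 := by
        rw [← Finset.card_union_of_disjoint hdis, ← hzu, hzc]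
      have hle : ∀ p ∈ H, y ∈ V p → (V z ∩ V p).card ≤ 2 := by
        intro p hp hyp
        have hlt : (V z ∩ V p).card < (V p).card :=
          Finset.card_lt_card ⟨Finset.inter_subset_right, fun hs =>
            hyz (Finset.mem_inter.1 (hs hyp)).1⟩
        rw [hS.card p hp] at hlt
        omega
      have l0 := hle _ he0 hy'.2
      have l1 := hle _ he1 hy'.1
      rcases Nat.lt_or_ge (V z ∩ V (e 0)).card 2 with h2 | h2
      · exact clash (e 1) (e 0) z he1 he0 hz (by rw [Finset.inter_comm, hy]) hyz (by omega) (by omega)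
      · exact clash (e 0) (e 1) z he0 he1 hz hy hyz (by omega) (by omega)
  -- Off `T`, keep a colouring that is good for all edges except `e 0`; that edge lies in `T`.
  have h1 := hmin (e 0) he0
  unfold IsUnavoidable at h1
  push Not at h1
  obtain ⟨χ, hχ⟩ := h1
  classical
  obtain ⟨z, hz, hzc⟩ := hH (fun v => if v ∈ T then (if v = y ∨ v = w then 0 else 1) else χ v)
  by_cases hzT : (V z ∩ T).Nonempty
  · have hsub := hin z hz hzT
    refine hcol z hz hsub ?_
    by_cases hz0 : col z = 0
    · left
      intro v hv
      have := hzc v hv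
      rw [if_pos (hsub hv), hz0] at this
      by_contra hcon
      rw [if_neg hcon] at this
      exact absurd this (by decide)
    · right
      intro v hv
      have := hzc v hv
      rw [if_pos (hsub hv)] at this
      by_contra hcon
      rw [if_pos (by tauto)] at this
      exact hz0 this.symm
  · have hnT : ∀ v ∈ V z, v ∉ T := fun v h1 h2 => hzT ⟨v, Finset.mem_inter.2 ⟨h1, h2⟩⟩
    have hze : z ≠ e 0 := by
      rintro rfl
      exact hnT y hy'.2 ((hT y).2 (Or.inr ⟨0, by omega, hy'.2⟩))
    obtain ⟨v, hv, hv'⟩ := hχ z ⟨hz, hze⟩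
    have := hzc v hv
    rw [if_neg (hnT v hv)] at this
    exact hv' this

end RadoHypergraph

/-! ### Counting solutions; ranks and the parameters `m` -/

namespace RadoMatrix

/-- A linear system of rank `r` in `q` unknowns has at most `n ^ (q - r)` solutions in `{1, …, n}`. -/
theorem card_solutions_le {ι κ : Type*} [Fintype ι] [DecidableEq ι] [Fintype κ] (M : Matrix κ ι ℚ)
    (b : κ → ℚ) (n : ℕ) (s : Finset (ι → ℕ)) (hs : ∀ x ∈ s, ∀ i, x i ∈ Finset.Icc 1 n)
    (hM : ∀ x ∈ s, M.mulVec (fun i => (x i : ℚ)) = b) :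
    s.card ≤ n ^ (Fintype.card ι - M.rank) := by
  classical
  -- Take columns that form a basis of the column space. The coordinates at all other columns
  -- determine the solution.
  obtain ⟨β, a, ha, hspan, hli⟩ := exists_linearIndependent' ℚ M.col
  have : Finite β := Finite.of_injective a ha
  have := Fintype.ofFinite β
  have hrank : M.rank = Fintype.card β := by
    rw [Matrix.rank_eq_finrank_span_cols, ← hspan, finrank_span_eq_card hli]
  let B : Finset ι := Finset.univ.image a
  have hB : B.card = M.rank := by
    rw [hrank, Finset.card_image_of_injective _ ha, Finset.card_univ]
  let t : Finset ({i // i ∉ B} → ℕ) := Fintype.piFinset fun _ => Finset.Icc 1 n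
  have ht : t.card = n ^ (Fintype.card ι - M.rank) := by
    simp [t, Fintype.card_piFinset, ← hB, Fintype.card_subtype_compl]
  rw [← ht]
  refine Finset.card_le_card_of_injOn (fun x i => x i.1) ?_ ?_
  · intro x hx
    simp only [t, Finset.mem_coe, Fintype.mem_piFinset]
    exact fun i => hs x hx _
  · intro x hx y hy hxy
    have hoff : ∀ i ∉ B, x i = y i := fun i hi => congrFun hxy ⟨i, hi⟩
    have h0 : ∑ i, ((x i : ℚ) - y i) • M.col i = 0 := by
      ext r
      have h1 := congrFun (hM x hx) r
      have h2 := congrFun (hM y hy) r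
      simp only [Matrix.mulVec, dotProduct] at h1 h2
      simp only [Finset.sum_apply, Pi.smul_apply, smul_eq_mul, Matrix.col_apply, Pi.zero_apply]
      rw [← sub_eq_zero.2 (h1.trans h2.symm), ← Finset.sum_sub_distrib]
      exact Finset.sum_congr rfl fun i _ => by ring
    have h1 : ∑ j, ((x (a j) : ℚ) - y (a j)) • (M.col ∘ a) j = 0 := by
      rw [← h0]
      have : ∑ i ∈ B, ((x i : ℚ) - y i) • M.col i = ∑ i, ((x i : ℚ) - y i) • M.col i :=
        Finset.sum_subset (Finset.subset_univ _) fun i _ hi => by rw [hoff i hi]; simp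
      rw [← this, Finset.sum_image (fun i _ j _ h => ha h)]
      rfl
    have h2 := Fintype.linearIndependent_iff.1 hli _ h1
    funext i
    by_cases hi : i ∈ B
    · obtain ⟨j, -, rfl⟩ := Finset.mem_image.1 hi
      exact_mod_cast sub_eq_zero.1 (h2 j)
    · exact hoff i hi

/-- The number of solutions with prescribed entries at the positions in `J`. -/
theorem card_solutions_fixed_le {ℓ k : ℕ} (C : Matrix (Fin ℓ) (Fin k) ℤ) (b : Fin ℓ → ℚ) (n : ℕ)
    (J : Finset (Fin k)) (v : Fin k → ℕ) (s : Finset (Fin k → ℕ))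
    (hs : ∀ x ∈ s, ∀ i, x i ∈ Finset.Icc 1 n)
    (hC : ∀ x ∈ s, (toRat C).mulVec (fun i => (x i : ℚ)) = b) (hv : ∀ x ∈ s, ∀ i ∈ J, x i = v i) :
    s.card ≤ n ^ (k - J.card - rkCompl C J) := by
  classical
  have hcard : Fintype.card {j : Fin k // j ∉ J} = k - J.card := by
    simp [Fintype.card_subtype_compl]
  have hinj : Set.InjOn (fun (x : Fin k → ℕ) (i : {j : Fin k // j ∉ J}) => x i.1) s := by
    intro x hx y hy hxy
    funext i
    by_cases hi : i ∈ J
    · rw [hv x hx i hi, hv y hy i hi]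
    · exact congrFun hxy ⟨i, hi⟩
  rw [← Finset.card_image_of_injOn hinj, ← hcard]
  refine card_solutions_le _ (fun r => b r - ∑ j ∈ J, toRat C r j * v j) n _ ?_ ?_
  · simp only [Finset.mem_image]
    rintro _ ⟨x, hx, rfl⟩ i
    exact hs x hx _
  · simp only [Finset.mem_image]
    rintro _ ⟨x, hx, rfl⟩
    ext r
    rw [← hC x hx]
    simp only [Matrix.mulVec, dotProduct, Matrix.submatrix_apply, id]
    rw [eq_sub_iff_add_eq, ← Finset.sum_add_sum_compl J, add_comm]
    congr 1
    · exact Finset.sum_congr rfl fun j hj => by rw [hv x hx j hj]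
    · exact (Finset.sum_subtype (p := fun j => j ∉ J) Jᶜ (by simp)
        (fun j => toRat C r j * (x j : ℚ))).symm

/-- No rational combination of the rows of `M` has exactly two nonzero entries. -/
def RowStar {ℓ k : ℕ} (M : Matrix (Fin ℓ) (Fin k) ℤ) : Prop :=
  ∀ c : Fin ℓ → ℚ, (Finset.univ.filter fun j => Matrix.vecMul c (toRat M) j ≠ 0).card ≠ 2

/-- Putting `c` in place of row `i` of the identity, where `c i ≠ 0`, gives an invertible matrix, so
every nonzero combination of rows occurs as a row after row operations. -/
theorem PropertyStar.rowStar {ℓ k : ℕ} {M : Matrix (Fin ℓ) (Fin k) ℤ} (h : PropertyStar M) :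
    RowStar M := by
  intro c hc
  have hne : c ≠ 0 := by
    rintro rfl
    simp at hc
  obtain ⟨i, hi⟩ := Function.ne_iff.1 hne
  have hdet : ((1 : Matrix (Fin ℓ) (Fin ℓ) ℚ).updateRow i c).det = c i := by
    rw [← Matrix.cramer_transpose_apply]
    simp
  refine h ((1 : Matrix (Fin ℓ) (Fin ℓ) ℚ).updateRow i c) ?_ i ?_
  · rw [Matrix.isUnit_iff_isUnit_det, hdet]
    exact isUnit_iff_ne_zero.2 hi
  · convert hc using 6
    rw [Matrix.mul_apply_eq_vecMul]
    simp

/-- `RowStar` passes to cores. -/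
theorem RowStar.of_submatrix {ℓ' k' ℓ k : ℕ} {M : Matrix (Fin ℓ') (Fin k') ℤ}
    {C : Matrix (Fin ℓ) (Fin k) ℤ} (h : RowStar M) (U : Matrix (Fin ℓ') (Fin ℓ') ℚ)
    (ρ : Fin ℓ ↪o Fin ℓ') (σ : Fin k ↪o Fin k')
    (hC : toRat C = (U * toRat M).submatrix ρ σ)
    (hz : ∀ i, ∀ j, j ∉ Set.range σ → (U * toRat M) (ρ i) j = 0) : RowStar C := by
  intro c hc
  -- `c'` forms the same combination before rows and columns are deleted. It vanishes in the deleted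
  -- columns, so the number of nonzero entries is unchanged.
  let c' : Fin ℓ' → ℚ := fun r => ∑ i, c i * U (ρ i) r
  have hc' : ∀ j, Matrix.vecMul c' (toRat M) j = ∑ i, c i * (U * toRat M) (ρ i) j := by
    intro j
    simp only [Matrix.vecMul, dotProduct, c', Matrix.mul_apply, Finset.sum_mul, Finset.mul_sum]
    rw [Finset.sum_comm]
    exact Finset.sum_congr rfl fun i _ => Finset.sum_congr rfl fun r _ => by ring
  refine h c' ?_
  rw [← hc, ← Finset.card_map σ.toEmbedding]
  congr 1
  ext j
  simp only [Finset.mem_filter, Finset.mem_univ, true_and, Finset.mem_map, hc']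
  constructor
  · intro hj
    by_cases hjr : j ∈ Set.range σ
    · obtain ⟨i, rfl⟩ := hjr
      refine ⟨i, ?_, rfl⟩
      simpa [Matrix.vecMul, dotProduct, hC] using hj
    · exact absurd (Finset.sum_eq_zero fun i _ => by rw [hz i j hjr, mul_zero]) hj
  · rintro ⟨i, hi, rfl⟩
    simpa [Matrix.vecMul, dotProduct, hC] using hi

/-- Deleting the columns in `W` lowers the rank by at most `|W| - 2`. -/
theorem rk_add_two_le {ℓ k : ℕ} {M : Matrix (Fin ℓ) (Fin k) ℤ} (h : RowStar M)
    (hirr : (LinearSystem.homogeneous M).Irredundant) {W : Finset (Fin k)} (hW : 2 ≤ W.card) :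
    rk M + 2 ≤ W.card + rkCompl M W := by
  classical
  by_contra hcon
  push Not at hcon
  obtain ⟨x, hxpos, hx'⟩ : ∃ x : Fin k → ℕ, (∀ j, 0 < x j) ∧
      (toRat M).mulVec (fun j => (x j : ℚ)) = 0 := by
    obtain ⟨x, hxpos, -, hx⟩ := hirr
    refine ⟨x, hxpos, ?_⟩
    ext r
    have := congrFun hx r
    simp only [LinearSystem.homogeneous, Matrix.mulVec, dotProduct, Pi.zero_apply] at this ⊢
    simp only [toRat, Matrix.map_apply]
    exact_mod_cast this
  obtain ⟨i, hi, j, hj, hij⟩ := Finset.one_lt_card.1 hW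
  -- If the claim fails, the columns other than `i` and `j` do not span the column space. A
  -- functional that kills them but not every column is a row combination supported in `{i, j}`;
  -- paired with the positive solution it must be nonzero at both, against `RowStar`.
  let R : Finset (Fin k) := (W.erase i).erase j
  have hR : R.card + 2 = W.card := by
    rw [Finset.card_erase_of_mem (Finset.mem_erase.2 ⟨hij.symm, hj⟩), Finset.card_erase_of_mem hi]
    omega
  let P : Submodule ℚ (Fin ℓ → ℚ) :=
    Submodule.span ℚ (Set.range ((toRat M).submatrix id (fun j : {j : Fin k // j ∉ W} => (j : Fin k))).col)
  let P' : Submodule ℚ (Fin ℓ → ℚ) := Submodule.span ℚ (R.image (toRat M).col : Finset _)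
  have hP : Module.finrank ℚ P = rkCompl M W := (Matrix.rank_eq_finrank_span_cols _).symm
  have hP' : Module.finrank ℚ P' ≤ R.card :=
    (finrank_span_finset_le_card _).trans Finset.card_image_le
  have hsup : Module.finrank ℚ (P ⊔ P' : Submodule ℚ (Fin ℓ → ℚ)) < rk M := by
    have := Submodule.finrank_add_le_finrank_add_finrank P P'
    omega
  have hmem : ∀ q, q ≠ i → q ≠ j → (toRat M).col q ∈ P ⊔ P' := by
    intro q hqi hqj
    by_cases hq : q ∈ W
    · refine Submodule.mem_sup_right (Submodule.subset_span ?_)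
      exact Finset.mem_coe.2 (Finset.mem_image_of_mem _ (by simp [R, hqi, hqj, hq]))
    · exact Submodule.mem_sup_left (Submodule.subset_span ⟨⟨q, hq⟩, rfl⟩)
  obtain ⟨q, hq⟩ : ∃ q, (toRat M).col q ∉ P ⊔ P' := by
    by_contra hall
    push Not at hall
    have hle : Submodule.span ℚ (Set.range (toRat M).col) ≤ P ⊔ P' :=
      Submodule.span_le.2 (by rintro _ ⟨q, rfl⟩; exact hall q)
    have := Submodule.finrank_mono hle
    rw [← Matrix.rank_eq_finrank_span_cols] at this
    exact absurd hsup (not_lt.2 this)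
  obtain ⟨φ, hφq, hφ⟩ := Submodule.exists_dual_map_eq_bot_of_notMem hq inferInstance
  have hφ0 : ∀ v ∈ P ⊔ P', φ v = 0 := by
    intro v hv
    have : φ v ∈ (P ⊔ P').map φ := Submodule.mem_map_of_mem hv
    rw [hφ] at this
    exact (Submodule.mem_bot ℚ).1 this
  obtain ⟨c, rfl⟩ := (dotProductEquiv ℚ (Fin ℓ)).surjective φ
  have hval : ∀ q, Matrix.vecMul c (toRat M) q = dotProductEquiv ℚ (Fin ℓ) c ((toRat M).col q) := by
    intro q
    simp [Matrix.vecMul, dotProductEquiv]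
    rfl
  have hzero : ∀ q, q ≠ i → q ≠ j → Matrix.vecMul c (toRat M) q = 0 := by
    intro q h1 h2
    rw [hval]
    exact hφ0 _ (hmem q h1 h2)
  have hsum : Matrix.vecMul c (toRat M) i * x i + Matrix.vecMul c (toRat M) j * x j = 0 := by
    have h1 : ∑ q, Matrix.vecMul c (toRat M) q * (x q : ℚ) = 0 := by
      change Matrix.vecMul c (toRat M) ⬝ᵥ (fun q => (x q : ℚ)) = 0
      rw [← Matrix.dotProduct_mulVec, hx']
      simp
    rw [← h1, ← Finset.sum_pair (f := fun q => Matrix.vecMul c (toRat M) q * (x q : ℚ)) hij]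
    refine Finset.sum_subset (Finset.subset_univ _) fun q _ hq => ?_
    simp only [Finset.mem_insert, Finset.mem_singleton, not_or] at hq
    rw [hzero q hq.1 hq.2, zero_mul]
  have hxi : (x i : ℚ) ≠ 0 := by
    exact_mod_cast (hxpos i).ne'
  have hxj : (x j : ℚ) ≠ 0 := by
    exact_mod_cast (hxpos j).ne'
  have hqne : Matrix.vecMul c (toRat M) q ≠ 0 := by rw [hval]; exact hφq
  have hci : Matrix.vecMul c (toRat M) i ≠ 0 := by
    intro h0
    rw [h0, zero_mul, zero_add, mul_eq_zero, or_iff_left hxj] at hsum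
    by_cases hqi : q = i
    · exact hqne (hqi ▸ h0)
    · by_cases hqj : q = j
      · exact hqne (hqj ▸ hsum)
      · exact hqne (hzero q hqi hqj)
  have hcj : Matrix.vecMul c (toRat M) j ≠ 0 := by
    intro h0
    rw [h0, zero_mul, add_zero, mul_eq_zero, or_iff_left hxi] at hsum
    exact hci hsum
  refine h c ?_
  rw [← Finset.card_pair hij]
  congr 1
  ext q
  simp only [Finset.mem_filter, Finset.mem_univ, true_and, Finset.mem_insert, Finset.mem_singleton]
  constructor
  · intro hq
    by_contra hn
    push Not at hn
    exact hq (hzero q hn.1 hn.2)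
  · rintro (rfl | rfl)
    exacts [hci, hcj]

theorem rkCompl_anti {ℓ k : ℕ} (M : Matrix (Fin ℓ) (Fin k) ℤ) {W W' : Finset (Fin k)}
    (h : W ⊆ W') : rkCompl M W' ≤ rkCompl M W := by
  unfold rkCompl
  exact Matrix.rank_submatrix_le
    ((toRat M).submatrix id (fun j : {j : Fin k // j ∉ W} => (j : Fin k))) id
    (fun j : {j : Fin k // j ∉ W'} => (⟨j.1, fun hj => j.2 (h hj)⟩ : {j : Fin k // j ∉ W}))

theorem rkCompl_le_rk {ℓ k : ℕ} (M : Matrix (Fin ℓ) (Fin k) ℤ) (W : Finset (Fin k)) :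
    rkCompl M W ≤ rk M :=
  Matrix.rank_submatrix_le _ _ _

theorem rkCompl_univ {ℓ k : ℕ} (M : Matrix (Fin ℓ) (Fin k) ℤ) : rkCompl M Finset.univ = 0 := by
  unfold rkCompl
  refine Nat.le_zero.1 ((Matrix.rank_le_card_width _).trans ?_)
  simp

/-- The numerical conditions on a core used by the random argument. -/
structure IsTight {ℓ k : ℕ} (C : Matrix (Fin ℓ) (Fin k) ℤ) : Prop where
  single : ∀ W : Finset (Fin k), W.card = 1 → rkCompl C W = ℓ
  pair : ∀ W : Finset (Fin k), W.card = 2 → rkCompl C W = ℓ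
  mid : ∀ W : Finset (Fin k), 2 ≤ W.card → W.card < k →
    (k - 1) * ℓ < (W.card - 1) * ℓ + (k - 1) * rkCompl C W

/-- `rk_add_two_le` shows that deleting two columns loses no rank, and makes the denominators in
strict balance positive; cleared of them, strict balance is `mid`. -/
theorem StrictlyBalanced.isTight {ℓ k : ℕ} (hk : ℓ + 2 ≤ k) {C : Matrix (Fin ℓ) (Fin k) ℤ}
    (hC : StrictlyBalanced C) (hstar : RowStar C)
    (hirr : (LinearSystem.homogeneous C).Irredundant) : IsTight C := by
  have hpair : ∀ W : Finset (Fin k), W.card = 2 → rkCompl C W = ℓ := by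
    intro W hW
    have h1 := rk_add_two_le hstar hirr hW.ge
    have h2 := rkCompl_le_rk C W
    rw [hC.1] at h1 h2
    omega
  refine ⟨fun W hW => ?_, hpair, fun W h2 hWk => ?_⟩
  · obtain ⟨W', hWW', hW'⟩ := Finset.exists_superset_card_eq (s := W) (n := 2) (by omega)
      (by simp; omega)
    have h1 := rkCompl_anti C hWW'
    have h2 := rkCompl_le_rk C W
    rw [hpair W' hW'] at h1
    rw [hC.1] at h2
    omega
  · have h1 := rk_add_two_le hstar hirr h2
    rw [hC.1] at h1
    have hb := hC.2 W h2 hWk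
    have hW1 : ((W.card - 1 : ℕ) : ℝ) = (W.card : ℝ) - 1 := by
      rw [Nat.cast_sub (by omega), Nat.cast_one]
    have hk1 : ((k - 1 : ℕ) : ℝ) = (k : ℝ) - 1 := by
      rw [Nat.cast_sub (by omega), Nat.cast_one]
    have h1' : (ℓ : ℝ) + 2 ≤ W.card + rkCompl C W := by exact_mod_cast h1
    have hk' : (ℓ : ℝ) + 2 ≤ k := by exact_mod_cast hk
    rw [div_lt_div_iff₀ (by linarith) (by linarith)] at hb
    have : ((k - 1 : ℕ) : ℝ) * ℓ < ((W.card - 1 : ℕ) : ℝ) * ℓ + ((k - 1 : ℕ) : ℝ) * rkCompl C W := by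
      rw [hW1, hk1]
      nlinarith
    exact_mod_cast this

theorem StrictlyBalanced.m_eq {ℓ k : ℕ} (hk : ℓ + 2 ≤ k) {C : Matrix (Fin ℓ) (Fin k) ℤ}
    (hC : StrictlyBalanced C) : m C = ((k : ℝ) - 1) / ((k : ℝ) - 1 - ℓ) := by
  have huniv : 2 ≤ (Finset.univ : Finset (Fin k)).card := by simp; omega
  have : Nonempty {W : Finset (Fin k) // 2 ≤ W.card} := ⟨⟨_, huniv⟩⟩
  unfold m
  refine le_antisymm (ciSup_le fun ⟨W, hW⟩ => ?_) ?_
  · rcases (Finset.card_le_univ W).lt_or_eq with h | h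
    · rw [Fintype.card_fin] at h
      rw [hC.1]
      exact (hC.2 W hW h).le
    · have hWu : W = Finset.univ := (Finset.card_eq_iff_eq_univ W).1 h
      subst hWu
      rw [hC.1, rkCompl_univ]
      simp
  · refine le_trans (le_of_eq ?_) (le_ciSup (Set.finite_range _).bddAbove ⟨_, huniv⟩)
    rw [hC.1, rkCompl_univ]
    simp

/-- If `m N = m M`, then `m (M, N) = m M`. -/
theorem mPair_eq {ℓ k ℓ' k' : ℕ} {M : Matrix (Fin ℓ) (Fin k) ℤ} {N : Matrix (Fin ℓ') (Fin k') ℤ}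
    (hk : 2 ≤ k) (hstar : RowStar M) (hirr : (LinearSystem.homogeneous M).Irredundant)
    {a : ℝ} (ha : 0 < a) (hM : m M = a) (hN : m N = a) : mPair M N = a := by
  have huniv : 2 ≤ (Finset.univ : Finset (Fin k)).card := by simp; omega
  have : Nonempty {W : Finset (Fin k) // 2 ≤ W.card} := ⟨⟨_, huniv⟩⟩
  have hpos : ∀ W : {W : Finset (Fin k) // 2 ≤ W.card},
      0 < (W.1.card : ℝ) - 1 + (rkCompl M W.1 : ℝ) - (rk M : ℝ) := by
    intro W
    have : (rk M : ℝ) + 2 ≤ W.1.card + rkCompl M W.1 := by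
      exact_mod_cast rk_add_two_le hstar hirr W.2
    linarith
  have hinv : 0 < 1 / a := by positivity
  unfold mPair
  unfold m at hM
  rw [hN]
  -- With `d` the denominator in `m M`, the inequality |W| - 1 ≤ a·d is equivalent to |W| ≤ a·(d +
  -- 1/a), and likewise for equality. Hence a maximiser for `m M` also serves here.
  refine le_antisymm (ciSup_le fun W => ?_) ?_
  · have h1 := le_ciSup (Set.finite_range _).bddAbove W (f := fun W : {W : Finset (Fin k) // 2 ≤ W.card} =>
      ((W.1.card : ℝ) - 1) / ((W.1.card : ℝ) - 1 + (rkCompl M W.1 : ℝ) - (rk M : ℝ)))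
    rw [hM, div_le_iff₀ (hpos W)] at h1
    have := hpos W
    rw [div_le_iff₀ (by positivity), mul_add, mul_one_div_cancel ha.ne']
    linarith
  · obtain ⟨W, hW⟩ := exists_eq_ciSup_of_finite
      (f := fun W : {W : Finset (Fin k) // 2 ≤ W.card} =>
      ((W.1.card : ℝ) - 1) / ((W.1.card : ℝ) - 1 + (rkCompl M W.1 : ℝ) - (rk M : ℝ)))
    refine le_trans (le_of_eq ?_) (le_ciSup (Set.finite_range _).bddAbove W)
    rw [hM, div_eq_iff (hpos W).ne'] at hW
    have := hpos W
    rw [eq_div_iff (by positivity), mul_add, mul_one_div_cancel ha.ne']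
    linarith

end RadoMatrix

/-! ### Weighted counts of attached edges -/

namespace RadoHypergraph

open RadoMatrix

variable {k ℓ : ℕ}

/-- The vertices of a coloured `k`-tuple. -/
def vert (e : Fin 2 × (Fin k → ℕ)) : Finset ℕ := Finset.univ.image e.2

/-- The positions at which the entries of `e` lie in `I`. -/
def positions (e : Fin 2 × (Fin k → ℕ)) (I : Finset ℕ) : Finset (Fin k) :=
  Finset.univ.filter fun j => e.2 j ∈ I

/-- The normalised cost of meeting the explored set exactly at the positions `J`. -/
noncomputable def positionCost (C : Fin 2 → Matrix (Fin ℓ) (Fin k) ℤ) (τ : Fin 2)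
    (J : Finset (Fin k)) : ℕ :=
  (J.card - 1) * ℓ + (k - 1) * rkCompl (C τ) J - (k - 1) * ℓ

/-- The cost of an edge that meets the explored set in `I`. -/
noncomputable def edgeCost (C : Fin 2 → Matrix (Fin ℓ) (Fin k) ℤ) (e : Fin 2 × (Fin k → ℕ))
    (I : Finset ℕ) : ℕ := positionCost C e.1 (positions e I)

open Classical in
/-- The coloured solutions in `{1, …, n}` with distinct entries of the systems `C τ x = b τ`. -/
noncomputable def edges (C : Fin 2 → Matrix (Fin ℓ) (Fin k) ℤ) (b : Fin 2 → Fin ℓ → ℚ) (n : ℕ) :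
    Finset (Fin 2 × (Fin k → ℕ)) :=
  (Finset.univ ×ˢ Fintype.piFinset fun _ => Finset.Icc 1 n).filter fun e =>
    Function.Injective e.2 ∧ (toRat (C e.1)).mulVec (fun i => (e.2 i : ℚ)) = b e.1

variable {C : Fin 2 → Matrix (Fin ℓ) (Fin k) ℤ} {b : Fin 2 → Fin ℓ → ℚ} {n : ℕ}

theorem mem_edges {e : Fin 2 × (Fin k → ℕ)} : e ∈ edges C b n ↔
    (∀ i, e.2 i ∈ Finset.Icc 1 n) ∧ Function.Injective e.2 ∧
      (toRat (C e.1)).mulVec (fun i => (e.2 i : ℚ)) = b e.1 := by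
  simp [edges]

theorem card_vert {e : Fin 2 × (Fin k → ℕ)} (he : e ∈ edges C b n) : (vert e).card = k := by
  rw [vert, Finset.card_image_of_injective _ (mem_edges.1 he).2.1]
  simp

theorem card_positions {e : Fin 2 × (Fin k → ℕ)} (he : e ∈ edges C b n) (X : Finset ℕ) :
    (positions e X).card = (vert e ∩ X).card := by
  rw [← Finset.card_image_of_injective (positions e X) (mem_edges.1 he).2.1]
  congr 1
  ext v
  simp only [positions, vert, Finset.mem_image, Finset.mem_filter, Finset.mem_univ, true_and,
    Finset.mem_inter]
  constructor
  · rintro ⟨j, hj, rfl⟩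
    exact ⟨⟨j, rfl⟩, hj⟩
  · rintro ⟨⟨j, rfl⟩, hj⟩
    exact ⟨j, hj, rfl⟩

theorem positions_inter (e : Fin 2 × (Fin k → ℕ)) (X : Finset ℕ) :
    positions e (vert e ∩ X) = positions e X := by
  ext j
  simp [positions, vert]

theorem card_union_vert {e : Fin 2 × (Fin k → ℕ)} (he : e ∈ edges C b n) (X : Finset ℕ) :
    (X ∪ vert e).card = X.card + (k - (positions e X).card) := by
  have h1 := Finset.card_union_add_card_inter X (vert e)
  have h2 := card_positions he X
  rw [card_vert he, Finset.inter_comm] at h1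
  have h3 : (vert e ∩ X).card ≤ (vert e).card := Finset.card_le_card Finset.inter_subset_left
  rw [card_vert he] at h3
  omega

/-- The number of edges of colour `τ` with the entries at the positions `J` in `Y`. -/
theorem card_edges_positions_le (τ : Fin 2) (J : Finset (Fin k)) (Y : Finset ℕ)
    (s : Finset (Fin 2 × (Fin k → ℕ))) (hs : s ⊆ edges C b n) (hτ : ∀ e ∈ s, e.1 = τ)
    (hJ : ∀ e ∈ s, ∀ j ∈ J, e.2 j ∈ Y) :
    s.card ≤ Y.card ^ J.card * n ^ (k - J.card - rkCompl (C τ) J) := by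
  classical
  let f : Fin 2 × (Fin k → ℕ) → (Fin k → ℕ) := fun e j => if j ∈ J then e.2 j else 0
  let t : Finset (Fin k → ℕ) := Fintype.piFinset fun j => if j ∈ J then Y else {0}
  have ht : t.card = Y.card ^ J.card := by
    simp only [t, Fintype.card_piFinset]
    rw [← Finset.prod_const, ← Finset.prod_subset (Finset.subset_univ J)]
    · exact Finset.prod_congr rfl fun j hj => by simp [hj]
    · intro j _ hj; simp [hj]
  rw [← ht, mul_comm]
  refine Finset.card_le_mul_card_image_of_maps_to (f := f) ?_ _ ?_
  · intro e he
    simp only [t, f, Fintype.mem_piFinset]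
    intro j
    by_cases hj : j ∈ J
    · simpa [hj] using hJ e he j hj
    · simp [hj]
  · intro v _
    have hinj : Set.InjOn (Prod.snd : Fin 2 × (Fin k → ℕ) → _) (s.filter fun e => f e = v) := by
      intro e he e' he' hee
      simp only [Finset.coe_filter, Set.mem_ofPred_eq] at he he'
      exact Prod.ext ((hτ e he.1).trans (hτ e' he'.1).symm) hee
    rw [← Finset.card_image_of_injOn hinj]
    refine card_solutions_fixed_le (C τ) (b τ) n J v _ ?_ ?_ ?_
    all_goals
      simp only [Finset.mem_image, Finset.mem_filter]
      rintro _ ⟨e, ⟨he, hev⟩, rfl⟩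
    · exact (mem_edges.1 (hs he)).1
    · have := (mem_edges.1 (hs he)).2.2
      rwa [hτ e he] at this
    · intro i hi
      rw [← hev]
      simp [f, hi]

/-- The exponents in the weight of a step cancel. -/
theorem exponent_identity (hk : ℓ + 2 ≤ k) (hC : ∀ τ, IsTight (C τ)) (τ : Fin 2)
    {J : Finset (Fin k)} (hJ : J.Nonempty) :
    (k - 1) * (k - J.card - rkCompl (C τ) J) + positionCost C τ J = (k - 1 - ℓ) * (k - J.card) := by
  have hJ1 := Finset.card_pos.2 hJ
  have hJk : J.card ≤ k := by simpa using Finset.card_le_univ J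
  have hr : rkCompl (C τ) J ≤ k - J.card := by
    refine (Matrix.rank_le_card_width _).trans (le_of_eq ?_)
    simp [Fintype.card_subtype_compl]
  -- Hence the truncated subtraction in `positionCost` is a genuine one.
  have hle : (k - 1) * ℓ ≤ (J.card - 1) * ℓ + (k - 1) * rkCompl (C τ) J := by
    rcases hJk.lt_or_eq with h | h
    · rcases Nat.lt_or_ge 1 J.card with h2 | h2
      · exact ((hC τ).mid J h2 h).le
      · rw [(hC τ).single J (by omega)]
        omega
    · rw [h]; omega
  unfold positionCost
  generalize rkCompl (C τ) J = r at *
  generalize J.card = j at *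
  obtain ⟨j, rfl⟩ : ∃ i, j = i + 1 := ⟨j - 1, by omega⟩
  obtain ⟨a, rfl⟩ : ∃ a, k = j + 1 + r + a := ⟨k - (j + 1) - r, by omega⟩
  obtain ⟨m, hm⟩ : ∃ m, j + 1 + r + a = ℓ + 1 + m := ⟨j + 1 + r + a - ℓ - 1, by omega⟩
  rw [show j + 1 + r + a - (j + 1) - r = a by omega, show j + 1 + r + a - 1 = j + r + a by omega,
    show j + r + a - ℓ = m by omega, show j + 1 + r + a - (j + 1) = r + a by omega,
    show j + 1 - 1 = j by omega] at *
  zify [hle]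
  have : (m : ℤ) = j + r + a - ℓ := by omega
  rw [this]
  ring

/-- The total weight of the ways to attach an edge at prescribed positions. -/
theorem sum_attach_le (hk : ℓ + 2 ≤ k) (hC : ∀ τ, IsTight (C τ)) {p y c : ℝ} (hp : 0 ≤ p)
    (hy : 0 ≤ y) (hyn : y ^ (k - 1) = n) (hpy : p * y ^ (k - 1 - ℓ) ≤ c) (τ : Fin 2)
    {J : Finset (Fin k)} (hJ : J.Nonempty) (Y : Finset ℕ) (s : Finset (Fin 2 × (Fin k → ℕ)))
    (hs : s ⊆ edges C b n) (hτ : ∀ e ∈ s, e.1 = τ) (hsJ : ∀ e ∈ s, ∀ j ∈ J, e.2 j ∈ Y) :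
    ∑ _e ∈ s, p ^ (k - J.card) * y ^ positionCost C τ J ≤ Y.card ^ J.card * c ^ (k - J.card) := by
  rw [Finset.sum_const, nsmul_eq_mul]
  have h1 : (s.card : ℝ) ≤ Y.card ^ J.card * (n : ℝ) ^ (k - J.card - rkCompl (C τ) J) := by
    exact_mod_cast card_edges_positions_le τ J Y s hs hτ hsJ
  calc (s.card : ℝ) * (p ^ (k - J.card) * y ^ positionCost C τ J)
      ≤ (Y.card ^ J.card * (n : ℝ) ^ (k - J.card - rkCompl (C τ) J)) *
          (p ^ (k - J.card) * y ^ positionCost C τ J) := by gcongr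
    _ = Y.card ^ J.card * (p * y ^ (k - 1 - ℓ)) ^ (k - J.card) := by
        rw [← hyn, mul_pow, ← pow_mul, ← pow_mul, ← exponent_identity hk hC τ hJ, pow_add]
        ring
    _ ≤ _ := by gcongr

theorem positionCost_of_card_eq_one (hC : ∀ τ, IsTight (C τ)) (τ : Fin 2) {J : Finset (Fin k)}
    (hJ : J.card = 1) : positionCost C τ J = 0 := by
  simp [positionCost, hJ, (hC τ).single J hJ]

/-- The total weight of the edges attached to an edge `e` in a single vertex. -/
theorem sum_ext_le (hk : ℓ + 2 ≤ k) (hC : ∀ τ, IsTight (C τ)) {p y c : ℝ} (hp : 0 ≤ p)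
    (hy : 0 ≤ y) (hyn : y ^ (k - 1) = n) (hpy : p * y ^ (k - 1 - ℓ) ≤ c) (Y : Finset ℕ)
    (s : Finset (Fin 2 × (Fin k → ℕ))) (hs : s ⊆ edges C b n)
    (hsY : ∀ e ∈ s, (vert e ∩ Y).Nonempty) :
    ∑ _e ∈ s, p ^ (k - 1) ≤ 2 * k * Y.card * c ^ (k - 1) := by
  classical
  -- One class for each colour and each position whose entry lies in `Y`, whence the factor `2 * k`.
  have hcov : s ⊆ (Finset.univ : Finset (Fin 2 × Fin k)).biUnion fun i =>
      s.filter fun e => e.1 = i.1 ∧ e.2 i.2 ∈ Y := by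
    intro e he
    obtain ⟨v, hv⟩ := hsY e he
    rw [Finset.mem_inter, vert, Finset.mem_image] at hv
    obtain ⟨⟨j, -, rfl⟩, hv⟩ := hv
    exact Finset.mem_biUnion.2 ⟨(e.1, j), Finset.mem_univ _, Finset.mem_filter.2 ⟨he, rfl, hv⟩⟩
  have hcard : (s.card : ℝ) ≤ ∑ i : Fin 2 × Fin k,
      ((s.filter fun e => e.1 = i.1 ∧ e.2 i.2 ∈ Y).card : ℝ) := by
    exact_mod_cast (Finset.card_le_card hcov).trans Finset.card_biUnion_le
  have hpc : 0 ≤ p ^ (k - 1) := by positivity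
  calc ∑ _e ∈ s, p ^ (k - 1) = s.card * p ^ (k - 1) := by rw [Finset.sum_const, nsmul_eq_mul]
    _ ≤ (∑ i : Fin 2 × Fin k, ((s.filter fun e => e.1 = i.1 ∧ e.2 i.2 ∈ Y).card : ℝ)) *
        p ^ (k - 1) := by gcongr
    _ = ∑ i : Fin 2 × Fin k, ((s.filter fun e => e.1 = i.1 ∧ e.2 i.2 ∈ Y).card : ℝ) * p ^ (k - 1) := by
        rw [Finset.sum_mul]
    _ ≤ ∑ i : Fin 2 × Fin k, (Y.card * c ^ (k - 1) : ℝ) := by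
        refine Finset.sum_le_sum fun i _ => ?_
        have := sum_attach_le hk hC hp hy hyn hpy i.1 (Finset.singleton_nonempty i.2) Y
          (s.filter fun e => e.1 = i.1 ∧ e.2 i.2 ∈ Y) ((Finset.filter_subset _ _).trans hs)
          (fun e he => (Finset.mem_filter.1 he).2.1)
          (fun e he j hj => by
            rw [Finset.mem_singleton.1 hj]; exact (Finset.mem_filter.1 he).2.2)
        rw [positionCost_of_card_eq_one hC _ (Finset.card_singleton _), Finset.sum_const,
          nsmul_eq_mul, Finset.card_singleton] at this
        simpa using this
    _ = 2 * k * Y.card * c ^ (k - 1) := by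
        simp
        ring

/-- The total weight of the edges that meet a given set. -/
theorem sum_free_le (hk : ℓ + 2 ≤ k) (hC : ∀ τ, IsTight (C τ)) {p y c : ℝ} (hp : 0 ≤ p)
    (hy : 0 ≤ y) (hyn : y ^ (k - 1) = n) (hpy : p * y ^ (k - 1 - ℓ) ≤ c) (hc : c ≤ 1) {N : ℕ}
    (hN : 1 ≤ N) (X : Finset ℕ) (hX : X.card ≤ N)
    (s : Finset (Fin 2 × (Fin k → ℕ))) (hs : s ⊆ edges C b n)
    (hsX : ∀ e ∈ s, (vert e ∩ X).Nonempty) :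
    ∑ e ∈ s, p ^ (k - (positions e X).card) * y ^ edgeCost C e (vert e ∩ X) ≤
      2 * 2 ^ k * N ^ k := by
  classical
  have hc0 : 0 ≤ c := le_trans (by positivity) hpy
  have hmaps : ∀ e ∈ s, (e.1, positions e X) ∈
      (Finset.univ : Finset (Fin 2 × Finset (Fin k))) := fun _ _ => Finset.mem_univ _
  rw [← Finset.sum_fiberwise_of_maps_to hmaps]
  calc _ ≤ ∑ i : Fin 2 × Finset (Fin k), (N ^ k : ℝ) := by
        refine Finset.sum_le_sum fun i _ => ?_
        by_cases hi : i.2.Nonempty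
        · have h1 := sum_attach_le hk hC hp hy hyn hpy i.1 hi X
            (s.filter fun e => (e.1, positions e X) = i) ((Finset.filter_subset _ _).trans hs)
            (fun e he => congrArg Prod.fst (Finset.mem_filter.1 he).2)
            (fun e he j hj => by
              have : positions e X = i.2 := congrArg Prod.snd (Finset.mem_filter.1 he).2
              rw [← this] at hj
              exact (Finset.mem_filter.1 hj).2)
          have h2 : (X.card : ℝ) ^ i.2.card * c ^ (k - i.2.card) ≤ N ^ k := by
            have hik : i.2.card ≤ k := by simpa using Finset.card_le_univ i.2
            calc (X.card : ℝ) ^ i.2.card * c ^ (k - i.2.card) ≤ (N : ℝ) ^ i.2.card * 1 := by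
                  gcongr
                  exact pow_le_one₀ hc0 hc
              _ ≤ N ^ k := by
                  rw [mul_one]
                  exact pow_le_pow_right₀ (by exact_mod_cast hN) hik
          refine le_trans (le_of_eq (Finset.sum_congr rfl fun e he => ?_)) (h1.trans h2)
          have h3 := (Finset.mem_filter.1 he).2
          rw [edgeCost, positions_inter, ← h3]
        · rw [Finset.sum_eq_zero]
          · positivity
          · intro e he
            exfalso
            obtain ⟨he, h3⟩ := Finset.mem_filter.1 he
            apply hi
            rw [← h3, ← Finset.card_pos, card_positions (hs he), Finset.card_pos]
            exact hsX e he
    _ = 2 * 2 ^ k * N ^ k := by simp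

/-- The total weight of all edges. -/
theorem sum_start_le (hk : ℓ + 2 ≤ k) (hC : ∀ τ, IsTight (C τ)) {p y c : ℝ} (hp : 0 ≤ p)
    (hy : 0 ≤ y) (hyn : y ^ (k - 1) = n) (hpy : p * y ^ (k - 1 - ℓ) ≤ c) (hc : c ≤ 1) :
    ∑ _e ∈ edges C b n, p ^ k ≤ 2 * y ^ ℓ := by
  classical
  have hmaps : ∀ e ∈ edges C b n, e.1 ∈ (Finset.univ : Finset (Fin 2)) :=
    fun _ _ => Finset.mem_univ _
  rw [← Finset.sum_fiberwise_of_maps_to hmaps]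
  have key : ∀ τ : Fin 2, ∑ _e ∈ (edges C b n).filter fun e => e.1 = τ, p ^ k ≤ y ^ ℓ := by
    intro τ
    rw [Finset.sum_const, nsmul_eq_mul]
    have hrk : rkCompl (C τ) ∅ = ℓ := by
      refine le_antisymm ((rkCompl_le_rk _ _).trans (Matrix.rank_le_height _)) ?_
      exact ((hC τ).single {⟨0, by omega⟩} (by simp)).ge.trans (rkCompl_anti _ (by simp))
    have h1 : (((edges C b n).filter fun e => e.1 = τ).card : ℝ) ≤ (n : ℝ) ^ (k - ℓ) := by
      have := card_edges_positions_le (C := C) (b := b) (n := n) τ ∅ ∅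
        ((edges C b n).filter fun e => e.1 = τ) (Finset.filter_subset _ _)
        (fun e he => (Finset.mem_filter.1 he).2) (by simp)
      simp only [hrk, Finset.card_empty, pow_zero, one_mul, Nat.sub_zero] at this
      exact_mod_cast this
    calc _ ≤ (n : ℝ) ^ (k - ℓ) * p ^ k := by gcongr
      _ = y ^ ℓ * (p * y ^ (k - 1 - ℓ)) ^ k := by
        -- Of the exponent of `y` in n^(k-ℓ), the `k` factors `p * y ^ (k - 1 - ℓ)` absorb all but
        -- `ℓ`.
        have : (k - 1) * (k - ℓ) = ℓ + (k - 1 - ℓ) * k := by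
          obtain ⟨a, rfl⟩ : ∃ a, k = ℓ + 1 + a := ⟨k - ℓ - 1, by omega⟩
          rw [show ℓ + 1 + a - 1 - ℓ = a by omega, show ℓ + 1 + a - 1 = ℓ + a by omega,
            show ℓ + 1 + a - ℓ = 1 + a by omega]
          ring
        rw [← hyn, mul_pow, ← pow_mul, ← pow_mul, this, pow_add]
        ring
      _ ≤ y ^ ℓ * 1 := by
        gcongr
        exact pow_le_one₀ (by positivity) (hpy.trans hc)
      _ = y ^ ℓ := mul_one _
  rw [Fin.sum_univ_two]
  linarith [key 0, key 1]

end RadoHypergraph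

/-! ### First moments of explorations -/

namespace RadoHypergraph

open RadoMatrix MeasureTheory ProbabilityTheory

variable {k ℓ : ℕ} {C : Fin 2 → Matrix (Fin ℓ) (Fin k) ℤ} {b : Fin 2 → Fin ℓ → ℚ} {n : ℕ}

/-- The state of an exploration: its cost, the explored set and the last edge. -/
abbrev State (k : ℕ) := ℕ × Finset ℕ × (Fin 2 × (Fin k → ℕ))

open Classical in
/-- The states reached from those in `Z` by a step that is not free. -/
noncomputable def extStates (C : Fin 2 → Matrix (Fin ℓ) (Fin k) ℤ) (b : Fin 2 → Fin ℓ → ℚ) (n : ℕ)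
    (Z : Finset (State k)) : Finset (State k) :=
  (Z.sigma fun t => (edges C b n).filter fun e =>
    (vert e ∩ t.2.1).card = 1 ∧ (vert e ∩ vert t.2.2).Nonempty).image
      fun a => (a.1.1, a.1.2.1 ∪ vert a.2, a.2)

open Classical in
/-- The states reached from those in `Z` by a free step. -/
noncomputable def freeStates (C : Fin 2 → Matrix (Fin ℓ) (Fin k) ℤ) (b : Fin 2 → Fin ℓ → ℚ) (n : ℕ)
    (Z : Finset (State k)) : Finset (State k) :=
  (Z.sigma fun t => (edges C b n).filter fun e => (vert e ∩ t.2.1).Nonempty).image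
      fun a => (a.1.1 + edgeCost C a.2 (vert a.2 ∩ a.1.2.1), a.1.2.1 ∪ vert a.2, a.2)

open Classical in
/-- The states of the explorations with `s + 1` edges, `r` of them added freely. -/
noncomputable def states (C : Fin 2 → Matrix (Fin ℓ) (Fin k) ℤ) (b : Fin 2 → Fin ℓ → ℚ) (n : ℕ) :
    ℕ → ℕ → Finset (State k)
  | 0, 0 => (edges C b n).image fun e => (0, vert e, e)
  | 0, _ + 1 => ∅
  | s + 1, 0 => extStates C b n (states C b n s 0)
  | s + 1, r + 1 => extStates C b n (states C b n s (r + 1)) ∪ freeStates C b n (states C b n s r)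

theorem extStates_subset_states (s r : ℕ) :
    extStates C b n (states C b n s r) ⊆ states C b n (s + 1) r := by
  cases r with
  | zero => simp [states]
  | succ r => rw [states]; exact Finset.subset_union_left

theorem Exploration.mem_states {s r q : ℕ} {X : Finset ℕ} {e : Fin 2 × (Fin k → ℕ)}
    (h : Exploration vert (edgeCost C) (edges C b n : Set _) s r q X e) :
    ∃ s', s = s' + 1 ∧ (q, X, e) ∈ states C b n s' r := by
  induction h with
  | start e he => exact ⟨0, rfl, by rw [states]; exact Finset.mem_image_of_mem _ he⟩
  | @ext s r q X e h e' he' h1 h2 ih =>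
    obtain ⟨s', rfl, hmem⟩ := ih
    refine ⟨s' + 1, rfl, extStates_subset_states _ _ (Finset.mem_image.2 ⟨⟨(q, X, e), e'⟩, ?_, rfl⟩)⟩
    exact Finset.mem_sigma.2 ⟨hmem, Finset.mem_filter.2 ⟨he', h1, h2⟩⟩
  | @free s r q X e h e' he' h1 ih =>
    obtain ⟨s', rfl, hmem⟩ := ih
    refine ⟨s' + 1, rfl, ?_⟩
    rw [states]
    refine Finset.mem_union_right _ (Finset.mem_image.2 ⟨⟨(q, X, e), e'⟩, ?_, rfl⟩)
    exact Finset.mem_sigma.2 ⟨hmem, Finset.mem_filter.2 ⟨he', h1⟩⟩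

theorem states_valid (s r : ℕ) : ∀ t ∈ states C b n s r,
    t.2.2 ∈ edges C b n ∧ t.2.1 ⊆ Finset.Icc 1 n ∧ t.2.1.card ≤ k * (s + 1) := by
  have hvert : ∀ e ∈ edges C b n, vert e ⊆ Finset.Icc 1 n := by
    intro e he v hv
    obtain ⟨j, -, rfl⟩ := Finset.mem_image.1 hv
    exact (mem_edges.1 he).1 j
  have hcard : ∀ (X : Finset ℕ) (s : ℕ), ∀ e ∈ edges C b n, X.card ≤ k * (s + 1) →
      (X ∪ vert e).card ≤ k * (s + 1 + 1) := by
    intro X s e he hX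
    have := Finset.card_union_le X (vert e)
    rw [card_vert he] at this
    rw [mul_add_one]
    omega
  have hext : ∀ (s : ℕ) (Z : Finset (State k)), (∀ t ∈ Z, t.2.2 ∈ edges C b n ∧
      t.2.1 ⊆ Finset.Icc 1 n ∧ t.2.1.card ≤ k * (s + 1)) → ∀ t ∈ extStates C b n Z,
      t.2.2 ∈ edges C b n ∧ t.2.1 ⊆ Finset.Icc 1 n ∧ t.2.1.card ≤ k * (s + 1 + 1) := by
    intro s Z hZ t ht
    obtain ⟨⟨t, e⟩, ha, rfl⟩ := Finset.mem_image.1 ht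
    obtain ⟨h1, h2⟩ := Finset.mem_sigma.1 ha
    have he := (Finset.mem_filter.1 h2).1
    exact ⟨he, Finset.union_subset (hZ t h1).2.1 (hvert e he), hcard _ _ _ he (hZ t h1).2.2⟩
  have hfree : ∀ (s : ℕ) (Z : Finset (State k)), (∀ t ∈ Z, t.2.2 ∈ edges C b n ∧
      t.2.1 ⊆ Finset.Icc 1 n ∧ t.2.1.card ≤ k * (s + 1)) → ∀ t ∈ freeStates C b n Z,
      t.2.2 ∈ edges C b n ∧ t.2.1 ⊆ Finset.Icc 1 n ∧ t.2.1.card ≤ k * (s + 1 + 1) := by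
    intro s Z hZ t ht
    obtain ⟨⟨t, e⟩, ha, rfl⟩ := Finset.mem_image.1 ht
    obtain ⟨h1, h2⟩ := Finset.mem_sigma.1 ha
    have he := (Finset.mem_filter.1 h2).1
    exact ⟨he, Finset.union_subset (hZ t h1).2.1 (hvert e he), hcard _ _ _ he (hZ t h1).2.2⟩
  induction s generalizing r with
  | zero =>
    cases r with
    | zero =>
      intro t ht
      rw [states] at ht
      obtain ⟨e, he, rfl⟩ := Finset.mem_image.1 ht
      exact ⟨he, hvert e he, by simp [card_vert he]⟩
    | succ r => simp [states]
  | succ s ih =>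
    cases r with
    | zero =>
      rw [states]
      exact hext s _ (ih 0)
    | succ r =>
      rw [states]
      intro t ht
      rcases Finset.mem_union.1 ht with h | h
      · exact hext s _ (ih _) t h
      · exact hfree s _ (ih _) t h

/-- The weight of a state. -/
noncomputable def weight (p y : ℝ) (t : State k) : ℝ := p ^ t.2.1.card * y ^ t.1

theorem weight_nonneg {p y : ℝ} (hp : 0 ≤ p) (hy : 0 ≤ y) (t : State k) : 0 ≤ weight p y t := by
  unfold weight; positivity

/-- A non-free step has to touch the previous edge, which has only `k` vertices, and costs nothing.
So its factor does not grow with the explored set, and long paths decay geometrically once `c` is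
small. -/
theorem sum_extStates_le (hk : ℓ + 2 ≤ k) (hC : ∀ τ, IsTight (C τ)) {p y c : ℝ} (hp : 0 ≤ p)
    (hy : 0 ≤ y) (hyn : y ^ (k - 1) = n) (hpy : p * y ^ (k - 1 - ℓ) ≤ c) (Z : Finset (State k))
    (hZ : ∀ t ∈ Z, t.2.2 ∈ edges C b n) :
    ∑ t ∈ extStates C b n Z, weight p y t ≤ (2 * k * k * c ^ (k - 1)) * ∑ t ∈ Z, weight p y t := by
  refine (Finset.sum_image_le_of_nonneg fun t _ => weight_nonneg hp hy t).trans ?_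
  rw [Finset.sum_sigma, Finset.mul_sum]
  refine Finset.sum_le_sum fun t ht => ?_
  have h1 := sum_ext_le hk hC hp hy hyn hpy (vert t.2.2) ((edges C b n).filter fun e =>
    (vert e ∩ t.2.1).card = 1 ∧ (vert e ∩ vert t.2.2).Nonempty) (Finset.filter_subset _ _)
    (fun e he => (Finset.mem_filter.1 he).2.2)
  rw [card_vert (hZ t ht)] at h1
  have h2 := mul_le_mul_of_nonneg_right h1 (weight_nonneg hp hy t)
  refine le_trans (le_of_eq ?_) h2
  rw [Finset.sum_mul]
  refine Finset.sum_congr rfl fun e he => ?_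
  obtain ⟨he, he1, -⟩ := Finset.mem_filter.1 he
  simp only [weight]
  rw [card_union_vert he, card_positions he, he1, pow_add]
  ring

/-- A free step may attach anywhere and loses a power of the size of the explored set. For sets of
logarithmic size this is affordable a bounded number of times. -/
theorem sum_freeStates_le (hk : ℓ + 2 ≤ k) (hC : ∀ τ, IsTight (C τ)) {p y c : ℝ} (hp : 0 ≤ p)
    (hy : 0 ≤ y) (hyn : y ^ (k - 1) = n) (hpy : p * y ^ (k - 1 - ℓ) ≤ c) (hc : c ≤ 1) {N : ℕ}
    (hN : 1 ≤ N) (Z : Finset (State k)) (hZ : ∀ t ∈ Z, t.2.1.card ≤ N) :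
    ∑ t ∈ freeStates C b n Z, weight p y t ≤ (2 * 2 ^ k * N ^ k) * ∑ t ∈ Z, weight p y t := by
  refine (Finset.sum_image_le_of_nonneg fun t _ => weight_nonneg hp hy t).trans ?_
  rw [Finset.sum_sigma, Finset.mul_sum]
  refine Finset.sum_le_sum fun t ht => ?_
  have h1 := sum_free_le hk hC hp hy hyn hpy hc hN t.2.1 (hZ t ht) ((edges C b n).filter fun e =>
    (vert e ∩ t.2.1).Nonempty) (Finset.filter_subset _ _) (fun e he => (Finset.mem_filter.1 he).2)
  have h2 := mul_le_mul_of_nonneg_right h1 (weight_nonneg hp hy t)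
  refine le_trans (le_of_eq ?_) h2
  rw [Finset.sum_mul]
  refine Finset.sum_congr rfl fun e he => ?_
  obtain ⟨he, -⟩ := Finset.mem_filter.1 he
  simp only [weight]
  rw [card_union_vert he, pow_add, pow_add]
  ring

/-- Induction on the number of edges. The factor `s + 1` per free step pays for the choice of the
moment at which it is taken; with no free step the bound keeps the decay `ρ ^ s`. -/
theorem sum_states_le (hk : ℓ + 2 ≤ k) (hC : ∀ τ, IsTight (C τ)) {p y c ρ : ℝ} (hp : 0 ≤ p)
    (hy : 0 ≤ y) (hyn : y ^ (k - 1) = n) (hpy : p * y ^ (k - 1 - ℓ) ≤ c) (hc : c ≤ 1)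
    (hρ : 2 * k * k * c ^ (k - 1) ≤ ρ) (hρ1 : ρ ≤ 1) {N : ℕ} (hN : 1 ≤ N) (s r : ℕ)
    (hs : k * (s + 1) ≤ N) :
    ∑ t ∈ states C b n s r, weight p y t ≤ 2 * y ^ ℓ * ((s + 1) * (2 * 2 ^ k * N ^ k)) ^ r ∧
      (r = 0 → ∑ t ∈ states C b n s r, weight p y t ≤ 2 * y ^ ℓ * ρ ^ s) := by
  have hc0 : 0 ≤ c := le_trans (by positivity) hpy
  have hρ0 : 0 ≤ ρ := le_trans (by positivity) hρ
  have hsum : ∀ Z : Finset (State k), 0 ≤ ∑ t ∈ Z, weight p y t := fun Z =>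
    Finset.sum_nonneg fun t _ => weight_nonneg hp hy t
  set M : ℝ := 2 * 2 ^ k * N ^ k with hM
  have hM0 : 0 ≤ M := by positivity
  have hext : ∀ s r, ∑ t ∈ extStates C b n (states C b n s r), weight p y t ≤
      ρ * ∑ t ∈ states C b n s r, weight p y t := fun s r =>
    (sum_extStates_le hk hC hp hy hyn hpy _ fun t ht => (states_valid s r t ht).1).trans
      (mul_le_mul_of_nonneg_right hρ (hsum _))
  induction s generalizing r with
  | zero =>
    cases r with
    | zero =>
      have : ∑ t ∈ states C b n 0 0, weight p y t ≤ 2 * y ^ ℓ := by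
        rw [states]
        refine (Finset.sum_image_le_of_nonneg fun t _ => weight_nonneg hp hy t).trans ?_
        refine le_trans (le_of_eq (Finset.sum_congr rfl fun e he => ?_))
          (sum_start_le (b := b) hk hC hp hy hyn hpy hc)
        simp [weight, card_vert he]
      exact ⟨by simpa using this, fun _ => by simpa using this⟩
    | succ r =>
      refine ⟨?_, by simp⟩
      simp only [states, Finset.sum_empty]
      positivity
  | succ s ih =>
    have hs' : k * (s + 1) ≤ N := le_trans (by gcongr; omega) hs
    cases r with
    | zero =>
      obtain ⟨-, h2⟩ := ih 0 hs'
      have h3 : ∑ t ∈ states C b n (s + 1) 0, weight p y t ≤ 2 * y ^ ℓ * ρ ^ (s + 1) := by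
        rw [states]
        calc _ ≤ ρ * ∑ t ∈ states C b n s 0, weight p y t := hext s 0
          _ ≤ ρ * (2 * y ^ ℓ * ρ ^ s) := by gcongr; exact h2 rfl
          _ = _ := by ring
      refine ⟨h3.trans ?_, fun _ => h3⟩
      rw [pow_zero]
      gcongr
      exact pow_le_one₀ hρ0 hρ1
    | succ r =>
      refine ⟨?_, by simp⟩
      obtain ⟨h1, -⟩ := ih (r + 1) hs'
      obtain ⟨h2, -⟩ := ih r hs'
      have hfree : ∑ t ∈ freeStates C b n (states C b n s r), weight p y t ≤
          M * ∑ t ∈ states C b n s r, weight p y t :=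
        sum_freeStates_le hk hC hp hy hyn hpy hc hN _ fun t ht =>
          (states_valid s r t ht).2.2.trans hs'
      rw [states]
      calc _ ≤ ∑ t ∈ extStates C b n (states C b n s (r + 1)), weight p y t +
            ∑ t ∈ freeStates C b n (states C b n s r), weight p y t := by
            rw [← Finset.sum_union_inter]
            exact le_add_of_nonneg_right (hsum _)
        _ ≤ 1 * (2 * y ^ ℓ * ((s + 1) * M) ^ (r + 1)) + M * (2 * y ^ ℓ * ((s + 1) * M) ^ r) := by
            refine add_le_add ((hext _ _).trans ?_) (hfree.trans ?_)
            · exact mul_le_mul hρ1 h1 (hsum _) zero_le_one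
            · gcongr
        _ = 2 * y ^ ℓ * (((s + 1) * M) ^ r * ((s + 1 + 1) * M)) := by ring
        _ ≤ 2 * y ^ ℓ * (((s + 1 + 1) * M) ^ r * ((s + 1 + 1) * M)) := by
            gcongr
            linarith
        _ = 2 * y ^ ℓ * (((s + 1 : ℕ) + 1) * M) ^ (r + 1) := by
            push_cast
            ring

/-! ### The union bound over the random set -/

/-- The probability that the random set contains `X`. -/
theorem setBernoulli_superset_le (u : Set ℕ) (p : unitInterval) (X : Finset ℕ) :
    setBernoulli u p {S : Set ℕ | (X : Set ℕ) ⊆ S} ≤ ENNReal.ofReal ((p : ℝ) ^ X.card) := by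
  rw [setBernoulli_apply']
  have hpre : (fun q : ℕ → Prop => {i | q i}) ⁻¹' {S : Set ℕ | (X : Set ℕ) ⊆ S} =
      Set.pi (X : Set ℕ) fun _ => {True} := by
    ext q
    simp [Set.pi, Set.subset_def]
  rw [hpre, Measure.infinitePi_pi _ (by measurability), ENNReal.ofReal_pow p.2.1,
    ← Finset.prod_const]
  refine Finset.prod_le_prod' fun i _ => ?_
  have h0 : (Measure.dirac False : Measure Prop) {True} = 0 := by simp
  -- Only an inequality, as points of `X` may lie outside `u`.
  have h1 : (Measure.dirac (i ∈ u) : Measure Prop) {True} ≤ 1 := prob_le_one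
  simp only [Measure.add_apply, Measure.smul_apply, h0, smul_zero, add_zero]
  calc unitInterval.toNNReal p • (Measure.dirac (i ∈ u) : Measure Prop) {True}
      ≤ (unitInterval.toNNReal p : ENNReal) * 1 := by
        rw [ENNReal.smul_def, smul_eq_mul]
        gcongr
    _ = ENNReal.ofReal p := by
        rw [mul_one, ENNReal.ofReal, Real.toNNReal_of_nonneg p.2.1]
        rfl

/-- Every finite unavoidable family contains a minimal one. -/
theorem exists_minimal_unavoidable {E : Type*} {V : E → Finset ℕ} {col : E → Fin 2} {H : Set E}
    (hfin : H.Finite) (hH : IsUnavoidable V col H) :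
    ∃ H' ⊆ H, IsUnavoidable V col H' ∧ ∀ e ∈ H', ¬ IsUnavoidable V col (H' \ {e}) := by
  obtain ⟨H', hle, hmin⟩ := (hfin.finite_subsets.inter_of_left {H' | IsUnavoidable V col H'}).exists_le_minimal
    (a := H) ⟨Set.Subset.refl H, hH⟩
  refine ⟨H', hle, hmin.prop.2, fun e he hcon => ?_⟩
  have := hmin.le_of_le (y := H' \ {e}) ⟨Set.sdiff_subset.trans hle, hcon⟩ Set.sdiff_subset
  exact (this he).2 rfl

/-- If no costly exploration and no long simple path lies in `S`, then the solutions in `S` are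
avoidable. -/
theorem not_unavoidable_of_states (hℓ : 0 < ℓ) (hk : ℓ + 2 ≤ k) (hC : ∀ τ, IsTight (C τ)) {L : ℕ}
    {S : Set ℕ}
    (hcheap : ∀ s < 2 * L + 10, ∀ r < 5, ∀ t ∈ states C b n s r, ℓ < t.1 → ¬ (t.2.1 : Set ℕ) ⊆ S)
    (hshort : ∀ t ∈ states C b n L 0, ¬ (t.2.1 : Set ℕ) ⊆ S) :
    ¬ IsUnavoidable vert Prod.fst {e | e ∈ edges C b n ∧ (vert e : Set ℕ) ⊆ S} := by
  intro hun
  obtain ⟨H, hH, hHun, hmin⟩ := exists_minimal_unavoidable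
    ((edges C b n).finite_toSet.subset fun e he => he.1) hun
  have hHe : H ⊆ (edges C b n : Set _) := fun e he => (hH he).1
  have hpos : ∀ e ∈ H, ∀ I ⊆ vert e, (positions e I).card = I.card := by
    intro e he I hI
    rw [card_positions (hHe he), Finset.inter_eq_right.2 hI]
  refine IsSparse.not_minimal (F := edgeCost C) (k := k) (ℓ := ℓ) (L := L) ?_ hHun hmin
  refine ⟨by omega, hℓ, fun e he => card_vert (hHe he), ?_, ?_, ?_, ?_,
    fun e he v hv => exists_inter_eq_singleton hHun hmin he hv⟩
  · intro e he I hI h2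
    have h2' := (hpos e he I hI).trans h2
    unfold edgeCost positionCost
    rw [h2', (hC e.1).pair _ h2']
    omega
  · intro e he I hI h2 hlt
    rw [← hpos e he I hI] at h2 hlt
    have := (hC e.1).mid _ h2 hlt
    unfold edgeCost positionCost
    omega
  · intro s r q X e hexp hs hr
    by_contra hq
    obtain ⟨s', rfl, hmem⟩ := (hexp.mono hHe).mem_states
    exact hcheap s' (by omega) r (by omega) _ hmem (by simpa using hq)
      (hexp.subset fun e he => (hH he).2)
  · intro q X e hexp
    obtain ⟨s', hs', hmem⟩ := (hexp.mono hHe).mem_states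
    obtain rfl : s' = L := by omega
    exact hshort _ hmem (hexp.subset fun e he => (hH he).2)

/-- The probability that the solutions in the random set are unavoidable. -/
theorem prob_unavoidable_le (hℓ : 0 < ℓ) (hk : ℓ + 2 ≤ k) (hC : ∀ τ, IsTight (C τ)) (L : ℕ)
    {p : unitInterval} {y c ρ : ℝ} (hy : 1 ≤ y) (hyn : y ^ (k - 1) = n)
    (hpy : p * y ^ (k - 1 - ℓ) ≤ c) (hc : c ≤ 1) (hρ : 2 * k * k * c ^ (k - 1) ≤ ρ) (hρ1 : ρ ≤ 1) :
    setBernoulli (Set.Icc 1 n) p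
      {S | IsUnavoidable vert Prod.fst {e | e ∈ edges C b n ∧ (vert e : Set ℕ) ⊆ S}} ≤
    ENNReal.ofReal (2 * y ^ ℓ * ρ ^ L + (2 * L + 10) * 5 *
      (2 * ((2 * L + 10) * (2 * 2 ^ k * (k * (2 * L + 10)) ^ k)) ^ 4) / y) := by
  classical
  have hp := p.2.1
  have hy0 : 0 < y := by linarith
  let bad : Finset (State k) := (Finset.range (2 * L + 10) ×ˢ Finset.range 5).biUnion fun i =>
    (states C b n i.1 i.2).filter fun t => ℓ < t.1
  have hsub : {S | IsUnavoidable vert Prod.fst {e | e ∈ edges C b n ∧ (vert e : Set ℕ) ⊆ S}} ⊆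
      (⋃ t ∈ states C b n L 0, {S : Set ℕ | (t.2.1 : Set ℕ) ⊆ S}) ∪
        ⋃ t ∈ bad, {S : Set ℕ | (t.2.1 : Set ℕ) ⊆ S} := by
    intro S hS
    by_contra hcon
    simp only [Set.mem_union, Set.mem_iUnion, Set.mem_ofPred_eq, not_or, not_exists] at hcon
    refine not_unavoidable_of_states hℓ hk hC (L := L) ?_ (fun t ht => hcon.1 t ht) hS
    intro s hs r hr t ht hlt
    refine hcon.2 t (Finset.mem_biUnion.2 ⟨(s, r), ?_, Finset.mem_filter.2 ⟨ht, hlt⟩⟩)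
    simp [hs, hr]
  have hmeas : ∀ Z : Finset (State k), setBernoulli (Set.Icc 1 n) p
      (⋃ t ∈ Z, {S : Set ℕ | (t.2.1 : Set ℕ) ⊆ S}) ≤
      ENNReal.ofReal (∑ t ∈ Z, (p : ℝ) ^ t.2.1.card) := by
    intro Z
    rw [ENNReal.ofReal_sum_of_nonneg fun t _ => by positivity]
    exact (measure_biUnion_finset_le Z _).trans
      (Finset.sum_le_sum fun t _ => setBernoulli_superset_le _ _ _)
  have hk1 : 1 ≤ k := by omega
  have hN : 1 ≤ k * (2 * L + 10) := Nat.mul_pos hk1 (by omega)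
  have hst := fun s r hs => sum_states_le (b := b) hk hC hp hy0.le hyn hpy hc hρ hρ1 hN s r hs
  have h1 : ∑ t ∈ states C b n L 0, (p : ℝ) ^ t.2.1.card ≤ 2 * y ^ ℓ * ρ ^ L := by
    refine le_trans (Finset.sum_le_sum fun t _ => ?_) ((hst L 0 (Nat.mul_le_mul_left k (by omega))).2 rfl)
    exact le_mul_of_one_le_right (by positivity) (one_le_pow₀ hy)
  set M : ℝ := 2 * 2 ^ k * (k * (2 * L + 10)) ^ k with hM
  have hM1 : 1 ≤ M := by
    have : (1 : ℝ) ≤ k * (2 * L + 10) := by exact_mod_cast hN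
    have h2 : (1 : ℝ) ≤ 2 ^ k := one_le_pow₀ (by norm_num)
    have h3 := one_le_pow₀ this (n := k)
    rw [hM]
    nlinarith [mul_le_mul h2 h3 (by norm_num) (by positivity)]
  have h2 : ∑ t ∈ bad, (p : ℝ) ^ t.2.1.card ≤ (2 * L + 10) * 5 * (2 * ((2 * L + 10) * M) ^ 4) / y := by
    have hone : ∀ i ∈ Finset.range (2 * L + 10) ×ˢ Finset.range 5,
        ∑ t ∈ (states C b n i.1 i.2).filter fun t => ℓ < t.1, (p : ℝ) ^ t.2.1.card ≤
          2 * ((2 * L + 10) * M) ^ 4 / y := by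
      rintro ⟨s, r⟩ hi
      simp only [Finset.mem_product, Finset.mem_range] at hi
      have h3 := (hst s r (Nat.mul_le_mul_left k (by omega))).1
      push_cast at h3
      rw [← hM] at h3
      have hsL : (s : ℝ) + 1 ≤ 2 * L + 10 := by exact_mod_cast hi.1
      -- Markov's inequality: a state of cost above `ℓ` carries a factor of at least `y ^ (ℓ + 1)`
      -- in its weight, one power more than the total weight supplies.
      calc ∑ t ∈ (states C b n s r).filter fun t => ℓ < t.1, (p : ℝ) ^ t.2.1.card
          ≤ ∑ t ∈ (states C b n s r).filter fun t => ℓ < t.1, weight p y t / y ^ (ℓ + 1) := by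
            refine Finset.sum_le_sum fun t ht => ?_
            rw [le_div_iff₀ (by positivity)]
            unfold weight
            gcongr
            exact (Finset.mem_filter.1 ht).2
        _ ≤ ∑ t ∈ states C b n s r, weight p y t / y ^ (ℓ + 1) :=
            Finset.sum_le_sum_of_subset_of_nonneg (Finset.filter_subset _ _) fun t _ _ =>
              div_nonneg (weight_nonneg hp hy0.le t) (by positivity)
        _ ≤ 2 * y ^ ℓ * ((s + 1) * M) ^ r / y ^ (ℓ + 1) := by
            rw [← Finset.sum_div]
            gcongr
        _ = 2 * ((s + 1) * M) ^ r / y := by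
            rw [pow_succ]
            field_simp
        _ ≤ 2 * ((2 * L + 10) * M) ^ r / y := by gcongr
        _ ≤ 2 * ((2 * L + 10) * M) ^ 4 / y := by
            have : (1 : ℝ) ≤ (2 * L + 10) * M := by
              have : (0 : ℝ) ≤ L := by positivity
              nlinarith
            gcongr
            omega
    calc _ ≤ ∑ i ∈ Finset.range (2 * L + 10) ×ˢ Finset.range 5,
          ∑ t ∈ (states C b n i.1 i.2).filter fun t => ℓ < t.1, (p : ℝ) ^ t.2.1.card := by
          have := Finset.sum_image_le_of_nonneg (s := (Finset.range (2 * L + 10) ×ˢ Finset.range 5).sigma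
            fun i => (states C b n i.1 i.2).filter fun t => ℓ < t.1) (g := fun a => a.2)
            (f := fun t : State k => (p : ℝ) ^ t.2.1.card) (fun t _ => by positivity)
          rw [Finset.sum_sigma] at this
          refine le_trans (le_of_eq (Finset.sum_congr ?_ fun _ _ => rfl)) this
          ext t
          simp only [bad, Finset.mem_biUnion, Finset.mem_image, Finset.mem_sigma]
          exact ⟨fun ⟨i, hi, h⟩ => ⟨⟨i, t⟩, ⟨hi, h⟩, rfl⟩, fun ⟨a, h, ha⟩ => ⟨a.1, h.1, ha ▸ h.2⟩⟩
      _ ≤ ∑ i ∈ Finset.range (2 * L + 10) ×ˢ Finset.range 5, 2 * ((2 * L + 10) * M) ^ 4 / y :=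
          Finset.sum_le_sum hone
      _ = _ := by
          rw [Finset.sum_const, Finset.card_product]
          simp
          ring
  calc _ ≤ _ := measure_mono hsub
    _ ≤ _ := measure_union_le _ _
    _ ≤ _ := add_le_add (hmeas _) (hmeas _)
    _ ≤ ENNReal.ofReal (2 * y ^ ℓ * ρ ^ L) + ENNReal.ofReal _ :=
        add_le_add (ENNReal.ofReal_le_ofReal h1) (ENNReal.ofReal_le_ofReal h2)
    _ = _ := (ENNReal.ofReal_add (le_trans (Finset.sum_nonneg fun t _ => by positivity) h1)
        (by positivity)).symm

end RadoHypergraph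

/-! ### Reduction to the cores and the limit -/

/-- A solution of a system restricts to a solution of a system with the core as underlying matrix. -/
theorem RadoMatrix.IsCore.exists_rhs {ℓ k : ℕ} {A : LinearSystem} {C : Matrix (Fin ℓ) (Fin k) ℤ}
    (h : RadoMatrix.IsCore A.matrix C) :
    ∃ (b : Fin ℓ → ℚ) (σ : Fin k ↪o Fin A.cols), ∀ x : Fin A.cols → ℕ,
      A.matrix.mulVec (fun j => (x j : ℤ)) = A.rhs →
      (RadoMatrix.toRat C).mulVec (fun j => (x (σ j) : ℚ)) = b := by
  classical
  obtain ⟨⟨U, -, ρ, σ, hC, hz⟩, -⟩ := h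
  refine ⟨fun i => U.mulVec (fun r => (A.rhs r : ℚ)) (ρ i), σ, fun x hx => ?_⟩
  have hx' : (RadoMatrix.toRat A.matrix).mulVec (fun j => (x j : ℚ)) = fun r => (A.rhs r : ℚ) := by
    ext r
    rw [← hx]
    simp [RadoMatrix.toRat, Matrix.mulVec, dotProduct]
  ext i
  rw [← hx', Matrix.mulVec_mulVec, hC]
  simp only [Matrix.mulVec, dotProduct, Matrix.submatrix_apply]
  refine (Finset.sum_map Finset.univ σ.toEmbedding
    (fun j => (U * RadoMatrix.toRat A.matrix) (ρ i) j * (x j : ℚ))).symm.trans ?_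
  refine Finset.sum_subset (Finset.subset_univ _) fun j _ hj => ?_
  rw [hz i j (by simpa using hj), zero_mul]

namespace RadoHypergraph

open RadoMatrix MeasureTheory ProbabilityTheory

theorem tendsto_log_pow_div_rpow (D : ℕ) {a : ℝ} (ha : 0 < a) (K : ℝ) :
    Tendsto (fun n : ℕ => K * (2 * (⌈Real.log n⌉₊ : ℝ) + 10) ^ D / (n : ℝ) ^ a) atTop (𝓝 0) := by
  have h1 : Tendsto (fun n : ℕ => Real.log n ^ D / (n : ℝ) ^ a) atTop (𝓝 0) := by
    have := ((isLittleO_log_rpow_rpow_atTop (D : ℝ) ha).tendsto_div_nhds_zero).comp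
      tendsto_natCast_atTop_atTop
    simpa [Function.comp_def] using this
  have h2 : Tendsto (fun n : ℕ => (2 * (⌈Real.log n⌉₊ : ℝ) + 10) ^ D / (n : ℝ) ^ a) atTop (𝓝 0) := by
    refine squeeze_zero' (Eventually.of_forall fun n => by positivity) ?_
      (by simpa using h1.const_mul ((14 : ℝ) ^ D))
    -- Once log n ≥ 1, 2⌈log n⌉ + 10 ≤ 2 log n + 12 ≤ 14 log n.
    filter_upwards [eventually_ge_atTop 3] with n hn
    have hlog : 1 ≤ Real.log n := by
      rw [Real.le_log_iff_exp_le (by positivity)]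
      have : (3 : ℝ) ≤ n := by exact_mod_cast hn
      linarith [Real.exp_one_lt_d9]
    have := (Nat.ceil_lt_add_one (zero_le_one.trans hlog)).le
    rw [← mul_div_assoc, ← mul_pow]
    gcongr
    linarith
  simpa [mul_div_assoc] using h2.const_mul K

/-- Take y = n^(1/(k-1)) and L = ⌈log n⌉. Long paths contribute at most 2n^(ℓ/(k-1) - 1), with
negative exponent because ℓ < k - 1; costly explorations contribute a polylogarithmic factor over y.
-/
theorem tendsto_prob_unavoidable {k ℓ : ℕ} (hℓ : 0 < ℓ) (hk : ℓ + 2 ≤ k)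
    {C : Fin 2 → Matrix (Fin ℓ) (Fin k) ℤ} (hC : ∀ τ, IsTight (C τ)) (b : Fin 2 → Fin ℓ → ℚ)
    {p : ℕ → unitInterval}
    (hp : ∀ᶠ n : ℕ in atTop,
      (p n : ℝ) ≤ 1 / (6 * k ^ 2) * (n : ℝ) ^ (-(((k : ℝ) - ℓ - 1) / ((k : ℝ) - 1)))) :
    Tendsto (fun n : ℕ => setBernoulli (Set.Icc 1 n) (p n)
      {S | IsUnavoidable vert Prod.fst {e | e ∈ edges C b n ∧ (vert e : Set ℕ) ⊆ S}})
      atTop (𝓝 0) := by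
  have hkR : (ℓ : ℝ) + 2 ≤ k := by exact_mod_cast hk
  have hℓR : (0 : ℝ) < ℓ := by exact_mod_cast hℓ
  have hk1 : (0 : ℝ) < (k : ℝ) - 1 := by linarith
  have hk1' : ((k - 1 : ℕ) : ℝ) = (k : ℝ) - 1 := by rw [Nat.cast_sub (by omega), Nat.cast_one]
  set a : ℝ := 1 / ((k : ℝ) - 1) with ha
  have ha0 : 0 < a := by positivity
  set c : ℝ := 1 / (6 * k ^ 2) with hc
  have hkpos : (0 : ℝ) < k := by linarith
  have hc0 : 0 < c := by positivity
  have hc1 : c ≤ 1 := by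
    rw [hc, div_le_one (by positivity)]
    nlinarith
  -- The value of `c` makes the decay factor at most 1/3 < 1/e, so ⌈log n⌉ steps gain a factor of n.
  have hρ : 2 * (k : ℝ) * k * c ^ (k - 1) ≤ Real.exp (-1) := by
    have h1 : c ^ (k - 1) ≤ c := pow_le_of_le_one hc0.le hc1 (by omega)
    calc 2 * (k : ℝ) * k * c ^ (k - 1) ≤ 2 * k * k * c := by gcongr
      _ = 3⁻¹ := by rw [hc]; field_simp; norm_num
      _ ≤ Real.exp (-1) := by
        rw [Real.exp_neg]
        gcongr
        linarith [Real.exp_one_lt_d9]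
  have hρ1 : Real.exp (-1) ≤ 1 := Real.exp_le_one_iff.2 (by norm_num)
  let g : ℕ → ℝ := fun n => 2 * ((n : ℝ) ^ a) ^ ℓ * Real.exp (-1) ^ ⌈Real.log n⌉₊ +
    (2 * (⌈Real.log n⌉₊ : ℝ) + 10) * 5 * (2 * ((2 * (⌈Real.log n⌉₊ : ℝ) + 10) *
      (2 * 2 ^ k * (k * (2 * (⌈Real.log n⌉₊ : ℝ) + 10)) ^ k)) ^ 4) / (n : ℝ) ^ a
  have hg : Tendsto g atTop (𝓝 0) := by
    rw [show (0 : ℝ) = 0 + 0 by simp]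
    refine Tendsto.add ?_ ?_
    · have h1 : Tendsto (fun n : ℕ => 2 * (n : ℝ) ^ (-(1 - a * ℓ))) atTop (𝓝 0) := by
        have hpos : 0 < 1 - a * ℓ := by
          rw [ha, one_div_mul_eq_div, sub_pos, div_lt_one hk1]
          linarith
        have := (tendsto_rpow_neg_atTop hpos).comp tendsto_natCast_atTop_atTop
        simpa [Function.comp_def] using this.const_mul 2
      refine squeeze_zero' (Eventually.of_forall fun n => by positivity) ?_ h1
      filter_upwards [eventually_ge_atTop 1] with n hn
      have hn0 : (0 : ℝ) < n := by exact_mod_cast hn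
      have h2 : Real.exp (-1) ^ ⌈Real.log n⌉₊ ≤ (n : ℝ)⁻¹ := by
        rw [← Real.exp_nat_mul, ← Real.exp_log hn0, ← Real.exp_neg, Real.exp_log hn0]
        gcongr
        linarith [Nat.le_ceil (Real.log n)]
      calc 2 * ((n : ℝ) ^ a) ^ ℓ * Real.exp (-1) ^ ⌈Real.log n⌉₊
          ≤ 2 * ((n : ℝ) ^ a) ^ ℓ * (n : ℝ)⁻¹ := by gcongr
        _ = 2 * (n : ℝ) ^ (-(1 - a * ℓ)) := by
          rw [← Real.rpow_mul_natCast hn0.le, mul_assoc, ← Real.rpow_neg_one, ← Real.rpow_add hn0]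
          congr 2
          ring
    · refine (tendsto_log_pow_div_rpow (1 + 4 * (1 + k)) ha0
        (10 * (2 * 2 ^ k * (k : ℝ) ^ k) ^ 4)).congr fun n => ?_
      congr 1
      generalize 2 * (⌈Real.log n⌉₊ : ℝ) + 10 = z
      ring
  have hg' : Tendsto (fun n => ENNReal.ofReal (g n)) atTop (𝓝 0) := by
    simpa using ENNReal.tendsto_ofReal hg
  refine tendsto_of_tendsto_of_tendsto_of_le_of_le' tendsto_const_nhds hg'
    (Eventually.of_forall fun _ => zero_le) ?_
  filter_upwards [hp, eventually_ge_atTop 1] with n hpn hn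
  have hn1 : (1 : ℝ) ≤ n := by exact_mod_cast hn
  have hn0 : (0 : ℝ) < n := by linarith
  refine prob_unavoidable_le hℓ hk hC ⌈Real.log n⌉₊ (y := (n : ℝ) ^ a)
    (Real.one_le_rpow hn1 ha0.le) ?_ ?_ hc1 hρ hρ1
  · rw [← Real.rpow_mul_natCast hn0.le, hk1', ha, one_div_mul_cancel hk1.ne', Real.rpow_one]
  · calc (p n : ℝ) * ((n : ℝ) ^ a) ^ (k - 1 - ℓ)
        ≤ c * (n : ℝ) ^ (-(((k : ℝ) - ℓ - 1) / ((k : ℝ) - 1))) * ((n : ℝ) ^ a) ^ (k - 1 - ℓ) := by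
          gcongr
      _ = c := by
          rw [← Real.rpow_mul_natCast hn0.le, mul_assoc, ← Real.rpow_add hn0,
            Nat.cast_sub (by omega), hk1', ha]
          rw [show -(((k : ℝ) - ℓ - 1) / ((k : ℝ) - 1)) + 1 / ((k : ℝ) - 1) * ((k : ℝ) - 1 - ℓ) = 0 by
            ring]
          simp
      _ ≤ c := le_rfl

/-- If a subset of `{1, …, n}` is Rado for two systems, then the coloured solutions in it of the
systems given by the cores are unavoidable. -/
theorem isUnavoidable_of_isRado {k ℓ : ℕ} {D : Fin 2 → LinearSystem}
    {C : Fin 2 → Matrix (Fin ℓ) (Fin k) ℤ} {b : Fin 2 → Fin ℓ → ℚ}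
    (hres : ∀ i : Fin 2, ∃ σ : Fin k ↪o Fin (D i).cols,
      ∀ x : Fin (D i).cols → ℕ,
      (D i).matrix.mulVec (fun j => (x j : ℤ)) =
        (D i).rhs →
      (toRat (C i)).mulVec (fun j => (x (σ j) : ℚ)) = b i) {n : ℕ} {S : Set ℕ}
    (hS : S ⊆ Set.Icc 1 n) (h : LinearSystem.IsRado D S) :
    IsUnavoidable vert Prod.fst {e | e ∈ edges C b n ∧ (vert e : Set ℕ) ⊆ S} := by
  intro χ
  obtain ⟨i, x, ⟨hxS, hinj, hx⟩, hχ⟩ := h χ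
  obtain ⟨σ, hσ⟩ := hres i
  refine ⟨(i, fun j => x (σ j)), ⟨mem_edges.2 ⟨fun j => ?_, hinj.comp σ.injective, hσ x hx⟩, ?_⟩, ?_⟩
  · have := hS (hxS (σ j))
    simpa using this
  · intro v hv
    obtain ⟨j, -, rfl⟩ := Finset.mem_image.1 (Finset.mem_coe.1 hv)
    exact hxS _
  · intro v hv
    obtain ⟨j, -, rfl⟩ := Finset.mem_image.1 hv
    exact hχ _

end RadoHypergraph

theorem theorem3p1 (k ℓ : ℕ) (hℓ : 0 < ℓ) (hk : ℓ + 2 ≤ k) :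
    ∃ c : ℝ, 0 < c ∧
      ∀ A B : LinearSystem,
        A.Irredundant → B.Irredundant →
        (LinearSystem.homogeneous A.matrix).Irredundant →
        (LinearSystem.homogeneous B.matrix).Irredundant →
        RadoMatrix.PropertyStar A.matrix → RadoMatrix.PropertyStar B.matrix →
        (∃ C : Matrix (Fin ℓ) (Fin k) ℤ, RadoMatrix.IsCore A.matrix C) →
        (∃ C : Matrix (Fin ℓ) (Fin k) ℤ, RadoMatrix.IsCore B.matrix C) →
        1 / RadoMatrix.mPair A.matrix B.matrix = ((k : ℝ) - ℓ - 1) / ((k : ℝ) - 1) ∧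
        ∀ p : ℕ → unitInterval,
          (∀ᶠ n : ℕ in atTop,
            (p n : ℝ) ≤ c * (n : ℝ) ^ (-(((k : ℝ) - ℓ - 1) / ((k : ℝ) - 1)))) →
          Tendsto
            (fun n : ℕ =>
              ProbabilityTheory.setBernoulli (Set.Icc 1 n) (p n)
                {S : Set ℕ | LinearSystem.IsRado ![A, B] S})
            atTop (𝓝 0) := by
  have hkR : (ℓ : ℝ) + 2 ≤ k := by exact_mod_cast hk
  have hℓR : (0 : ℝ) < ℓ := by exact_mod_cast hℓ
  refine ⟨1 / (6 * k ^ 2), by have : 0 < k := by omega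
                              positivity, ?_⟩
  rintro A B - - hA hB hAs hBs ⟨CA, hCA⟩ ⟨CB, hCB⟩
  have tight : ∀ (D : LinearSystem) (C : Matrix (Fin ℓ) (Fin k) ℤ),
      RadoMatrix.PropertyStar D.matrix → RadoMatrix.IsCore D.matrix C → RadoMatrix.IsTight C := by
    rintro D C hD ⟨⟨U, -, ρ, σ, hC, hz⟩, hirr, hbal, -⟩
    exact hbal.isTight hk (hD.rowStar.of_submatrix U ρ σ hC hz) hirr
  constructor
  · have hmA := hCA.2.2.1.m_eq hk
    have hmB := hCB.2.2.1.m_eq hk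
    rw [hCA.2.2.2] at hmA
    rw [hCB.2.2.2] at hmB
    obtain ⟨-, -, -, σ, -⟩ := hCA.1
    have hcols : k ≤ A.cols := by simpa using Fintype.card_le_of_embedding σ.toEmbedding
    rw [RadoMatrix.mPair_eq (by omega) hAs.rowStar hA (div_pos (by linarith) (by linarith)) hmA hmB,
      one_div_div]
    congr 1
    ring
  · intro p hp
    obtain ⟨bA, σA, hbA⟩ := hCA.exists_rhs
    obtain ⟨bB, σB, hbB⟩ := hCB.exists_rhs
    have hC : ∀ τ, RadoMatrix.IsTight ((![CA, CB] : Fin 2 → Matrix (Fin ℓ) (Fin k) ℤ) τ) :=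
      Fin.forall_fin_two.2 ⟨tight A CA hAs hCA, tight B CB hBs hCB⟩
    refine tendsto_of_tendsto_of_tendsto_of_le_of_le tendsto_const_nhds
      (RadoHypergraph.tendsto_prob_unavoidable hℓ hk hC ![bA, bB] hp) (fun _ => zero_le) fun n => ?_
    dsimp only
    -- The measure lives on subsets of {1, …, n}, as `isUnavoidable_of_isRado` requires.
    rw [ProbabilityTheory.setBernoulli_apply_eq_apply_subsets]
    refine MeasureTheory.measure_mono fun S hS => ?_
    exact RadoHypergraph.isUnavoidable_of_isRado (C := ![CA, CB]) (b := ![bA, bB])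
      (D := ![A, B]) (Fin.forall_fin_two.2 ⟨⟨σA, hbA⟩, ⟨σB, hbB⟩⟩) hS.2 hS.1
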